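/- Let $m\geqslant 1$. A Calabi–Yau $m$-fold is a quadruple $(M,J,g,\Omega)$, where $(M,J)$ is a (Hausdorff) complex $m$-manifold, not necessarily compact, $g$ is a Kähler metric on it with Kähler form $\omega$, and $\Omega$ is a holomorphic $(m,0)$-form with $\omega^m/m!=(-1)^{m(m-1)/2}(i/2)^m\,\Omega\wedge\bar\Omega$. The standard example is $\mathbb{C}^m$ with $g=|dz_1|^2+\cdots+|dz_m|^2$ and $\Omega=dz_1\wedge\cdots\wedge dz_m$. A (compact) immersed graded Lagrangian in $M$ is a (compact) nonempty oriented smooth $m$-manifold $L$ without boundary, not necessarily connected, with a smooth immersion $\iota:L\to M$ satisfying $\iota^*\omega=0$ and a smooth function $\theta_L:L\to\mathbb{R}$ with $\iota^*\Omega=e^{i\theta_L}\,dV_L$, where $dV_L$ is the volume form of $\iota^*g$ and the orientation. Its phase variation is $\sup_L\theta_L-\inf_L\theta_L$, and it is almost calibrated if for some $\phi\in\mathbb{R}$ the $m$-form $\iota^*(\cos\phi\,\mathrm{Re}\,\Omega-\sin\phi\,\mathrm{Im}\,\Omega)$ is positive on $L$. **(a)** Every compact, immersed, graded Lagrangian in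 $\mathbb{C}^m$ has phase variation greater than $\pi$, and is not almost calibrated. **(b)** Let $(M,J,g,\Omega)$ be a Calabi–Yau $m$-fold and $p\in M$. Then there is $\delta_0>0$ such that for every $0<\delta\leqslant\delta_0$, every compact, immersed, graded Lagrangian in $M$ whose image lies in the open Riemannian ball $B_\delta(p)$ has phase variation greater than $\pi$, and is not almost calibrated. **(c)** Consequently "collapsing a zero object" does not occur for almost calibrated Lagrangians, in particular not in almost calibrated Lagrangian mean curvature flow: let $(M,J,g,\Omega)$ be a Calabi–Yau $m$-fold, $p\in M$, and let $(L^t)_{t\in(T-\epsilon,T)}$, $\epsilon>0$, be any family of compact, immersed, graded Lagrangians in $M$. Suppose that for each $t$ there is a nonempty open and closed part $L_1^t\subseteq L^t$ whose image lies in $B_{\delta(t)}(p)$, where $\delta(t)\to 0$ as $t\to T$ from below. Then for all $t<T$ sufficiently close to $T$, $L^t$ has phase variation greater than $\pi$ and is not almost calibrated. -/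

import Mathlib

open Bundle Filter Set
open scoped Manifold ContDiff Topology

noncomputable section

/-- The complex vector space `ℂ^m` with its Euclidean norm; all complex manifolds below are modelled
on it. Its underlying real inner product space carries the metric `|dz₁|² + ⋯ + |dz_m|²`. -/
abbrev Cm (m : ℕ) : Type := EuclideanSpace ℂ (Fin m)

/-- The real tangent space of a complex manifold. As Mathlib realises `T_xM` by the model space
through the preferred chart at `x`, it has the same elements as the complex tangent space. -/
abbrev RTangent (m : ℕ) {M : Type*} [TopologicalSpace M] [ChartedSpace (Cm m) M] (x : M) : Type :=
  TangentSpace 𝓘(ℝ, Cm m) x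

/-- The holomorphic tangent space of a complex manifold. -/
abbrev CTangent (m : ℕ) {M : Type*} [TopologicalSpace M] [ChartedSpace (Cm m) M] (x : M) : Type :=
  TangentSpace 𝓘(ℂ, Cm m) x

/-- A complex manifold is in particular a real analytic manifold. -/
instance isManifold_real {m : ℕ} {M : Type*} [TopologicalSpace M] [ChartedSpace (Cm m) M]
    [IsManifold 𝓘(ℂ, Cm m) ω M] : IsManifold 𝓘(ℝ, Cm m) ω M := by
  apply isManifold_of_contDiffOn
  intro e e' he he'
  have h := (contDiffGroupoid ω 𝓘(ℂ, Cm m)).compatible he he'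
  rw [contDiffGroupoid, mem_groupoid_of_pregroupoid] at h
  exact h.1.restrict_scalars ℝ

/-- The complex structure `J` on the real tangent spaces: multiplication by `i`. -/
def complexStructure (m : ℕ) {M : Type*} [TopologicalSpace M] [ChartedSpace (Cm m) M] (x : M) :
    RTangent m x →L[ℝ] RTangent m x :=
  ((Complex.I • ContinuousLinearMap.id ℝ (Cm m) : Cm m →L[ℝ] Cm m))

/-- A complex `m`-manifold with a smooth Hermitian metric `g` and a complex `m`-linear alternating
form `Ω` on each tangent space, that is, an `(m,0)`-form (no condition on `Ω` yet). -/
structure HermitianData (m : ℕ) (M : Type*) [TopologicalSpace M] [ChartedSpace (Cm m) M]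
    [IsManifold 𝓘(ℂ, Cm m) ω M] where
  /-- the Riemannian metric -/
  g : ContMDiffRiemannianMetric 𝓘(ℝ, Cm m) ∞ (Cm m) (fun x : M => TangentSpace 𝓘(ℝ, Cm m) x)
  /-- `g` is `J`-invariant -/
  hermitian : ∀ (x : M) (u v : RTangent m x),
    g.inner x (complexStructure m x u) (complexStructure m x v) = g.inner x u v
  /-- the `(m,0)`-form -/
  Om : ∀ x : M, CTangent m x [⋀^Fin m]→L[ℂ] ℂ

section Wedge

variable {V : Type*} [AddCommGroup V] [Module ℝ V]

/-- The wedge product of complex valued alternating forms on a real vector space,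
`(α ∧ β)(v₁, …, v_{p+q}) = ∑ sgn(σ) α(v_{σ1}, …, v_{σp}) β(v_{σ(p+1)}, …, v_{σ(p+q)})`,
the sum being over the `(p,q)`-shuffles `σ`. -/
def wedge {p q : ℕ} (α : V [⋀^Fin p]→ₗ[ℝ] ℂ) (β : V [⋀^Fin q]→ₗ[ℝ] ℂ) :
    V [⋀^Fin (p + q)]→ₗ[ℝ] ℂ :=
  ((LinearMap.mul' ℝ ℂ).compAlternatingMap (α.domCoprod β)).domDomCongr finSumFinEquiv

/-- The `k`-th wedge power `α ∧ ⋯ ∧ α` of a `2`-form. -/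
def wedgePow (α : V [⋀^Fin 2]→ₗ[ℝ] ℂ) : (k : ℕ) → V [⋀^Fin (2 * k)]→ₗ[ℝ] ℂ
  | 0 => AlternatingMap.constOfIsEmpty ℝ V (Fin 0) 1
  | k + 1 => wedge (wedgePow α k) α

end Wedge

namespace HermitianData

variable {m : ℕ} {M : Type*} [TopologicalSpace M] [ChartedSpace (Cm m) M]
  [IsManifold 𝓘(ℂ, Cm m) ω M]

theorem inner_J_self (X : HermitianData m M) (x : M) (u : RTangent m x) :
    X.g.inner x (complexStructure m x u) u = 0 := by
  have hJ : complexStructure m x (complexStructure m x u) = -u := by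
    have key : ∀ w : Cm m, Complex.I • (Complex.I • w) = -w := fun w => by
      rw [smul_smul, Complex.I_mul_I, neg_one_smul]
    exact key u
  have h := X.hermitian x (complexStructure m x u) u
  rw [hJ, map_neg, neg_apply, X.g.symm] at h
  linarith

/-- The Hermitian (Kähler) form `ω(u,v) = g(Ju,v)`. -/
def kahlerForm (X : HermitianData m M) (x : M) : RTangent m x [⋀^Fin 2]→L[ℝ] ℝ where
  toFun v := X.g.inner x (complexStructure m x (v 0)) (v 1)
  map_update_add' := by
    intro _ v i a b
    fin_cases i <;> simp [Function.update]
  map_update_smul' := by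
    intro _ v i a b
    fin_cases i <;> simp [Function.update]
  cont := by
    have key : ∀ B : Cm m →L[ℝ] Cm m →L[ℝ] ℝ, Continuous fun v : Fin 2 → Cm m => B (v 0) (v 1) :=
      fun B => by fun_prop
    exact key ((X.g.inner x).comp (complexStructure m x))
  map_eq_zero_of_eq' := by
    intro v i j hv hij
    have h01 : v 0 = v 1 := by
      fin_cases i <;> fin_cases j <;> simp_all
    rw [h01]
    exact X.inner_J_self x _

/-- `Ω` as a complex valued form on the real tangent spaces. -/
def OmReal (X : HermitianData m M) (x : M) : RTangent m x [⋀^Fin m]→L[ℝ] ℂ :=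
  let W : Cm m [⋀^Fin m]→L[ℂ] ℂ := X.Om x
  W.restrictScalars ℝ

/-- The Kähler form in the chart at `x₀`. -/
def kahlerFormInChart (X : HermitianData m M) (x₀ : M) (y : Cm m) : Cm m [⋀^Fin 2]→L[ℝ] ℝ :=
  (X.kahlerForm ((chartAt (Cm m) x₀).symm y)).compContinuousLinearMap
    (mfderiv 𝓘(ℝ, Cm m) 𝓘(ℝ, Cm m) (chartAt (Cm m) x₀).symm y)

/-- The form `Ω` in the chart at `x₀`. -/
def OmInChart (X : HermitianData m M) (x₀ : M) (y : Cm m) : Cm m [⋀^Fin m]→L[ℂ] ℂ :=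
  (X.Om ((chartAt (Cm m) x₀).symm y)).compContinuousLinearMap
    (mfderiv 𝓘(ℂ, Cm m) 𝓘(ℂ, Cm m) (chartAt (Cm m) x₀).symm y)

/-- The Kähler form at `x` as a complex valued form. -/
def kahlerFormC (X : HermitianData m M) (x : M) : RTangent m x [⋀^Fin 2]→ₗ[ℝ] ℂ :=
  (Complex.ofRealCLM : ℝ →ₗ[ℝ] ℂ).compAlternatingMap (X.kahlerForm x).toAlternatingMap

/-- The complex conjugate form `Ω̄` at `x`. -/
def OmConj (X : HermitianData m M) (x : M) : RTangent m x [⋀^Fin m]→ₗ[ℝ] ℂ :=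
  (Complex.conjLIE : ℂ →ₗ[ℝ] ℂ).compAlternatingMap (X.OmReal x).toAlternatingMap

/-- `(M,J,g,Ω)` is a Calabi–Yau `m`-fold: the metric is Kähler, `Ω` is holomorphic, and
`ω^m / m! = (-1)^{m(m-1)/2} (i/2)^m Ω ∧ Ω̄`. -/
structure IsCalabiYau (X : HermitianData m M) : Prop where
  kahler : ∀ x₀ : M, ∀ y ∈ (chartAt (Cm m) x₀).target, extDeriv (X.kahlerFormInChart x₀) y = 0
  holomorphic : ∀ x₀ : M, DifferentiableOn ℂ (X.OmInChart x₀) (chartAt (Cm m) x₀).target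
  normalized : ∀ (x : M) (v : Fin (2 * m) → RTangent m x),
    wedgePow (X.kahlerFormC x) m v / (m.factorial : ℂ) =
      (-1) ^ (m * (m - 1) / 2) * (Complex.I / 2) ^ m *
        wedge (X.OmReal x).toAlternatingMap (X.OmConj x) (v ∘ Fin.cast (two_mul m).symm)

/-- The open ball `B_δ(p)` for the Riemannian distance of `g`. -/
def ball (X : HermitianData m M) (p : M) (δ : ℝ) : Set M :=
  letI : RiemannianBundle (fun x : M => TangentSpace 𝓘(ℝ, Cm m) x) := ⟨X.g.toRiemannianMetric⟩
  {q | Manifold.riemannianEDist 𝓘(ℝ, Cm m) p q < ENNReal.ofReal δ}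

end HermitianData

/-- `ℂ^m` with `g = |dz₁|² + ⋯ + |dz_m|²` and `Ω = dz₁ ∧ ⋯ ∧ dz_m`, that is,
`Ω(v₁, …, v_m) = det (z_j(v_i))`. -/
def flatData (m : ℕ) : HermitianData m (Cm m) where
  g := { riemannianMetricVectorSpace (Cm m) with
    contMDiff := (riemannianMetricVectorSpace (Cm m)).contMDiff.of_le le_top }
  hermitian := by
    intro x u v
    have key : ∀ a b : Cm m, inner ℝ (Complex.I • a) (Complex.I • b) = inner ℝ a b := fun a b => by
      simp only [PiLp.inner_apply]
      refine Finset.sum_congr rfl fun i _ => ?_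
      simp [Complex.inner]
    exact key u v
  Om := fun _ =>
    (ContinuousAlternatingMap.compContinuousLinearMap
      ({ Matrix.detRowAlternating with
          cont := Continuous.matrix_det (continuous_id (X := Fin m → Fin m → ℂ)) } :
        (Fin m → ℂ) [⋀^Fin m]→L[ℂ] ℂ)
      (EuclideanSpace.equiv (Fin m) ℂ).toContinuousLinearMap : Cm m [⋀^Fin m]→L[ℂ] ℂ)

section Lagrangian

/-- The ordered family `v` is a basis in the class of the orientation `o`. -/
def IsPositiveFrame {V : Type*} [AddCommGroup V] [Module ℝ V] {m : ℕ}
    (o : Orientation ℝ V (Fin m)) (v : Fin m → V) : Prop :=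
  ∃ b : Module.Basis (Fin m) ℝ V, ⇑b = v ∧ b.orientation = o

variable {m : ℕ} {L : Type*} [TopologicalSpace L] [ChartedSpace (EuclideanSpace ℝ (Fin m)) L]
  [IsManifold (𝓡 m) ∞ L]

/-- The coordinate frame `∂/∂x₁, …, ∂/∂x_m` at `x` of the chart at `x₀` (for `x` in its domain). -/
def coordFrame (x₀ x : L) (i : Fin m) : TangentSpace (𝓡 m) x :=
  (trivializationAt (EuclideanSpace ℝ (Fin m)) (TangentSpace (𝓡 m)) x₀).symmL ℝ x
    (EuclideanSpace.single i 1)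

/-- A choice of orientations of the tangent spaces of `L` is an orientation of `L` if whether a
coordinate frame is positive is locally constant. -/
def IsManifoldOrientation (o : ∀ x : L, Orientation ℝ (TangentSpace (𝓡 m) x) (Fin m)) : Prop :=
  ∀ x₀ : L, ∀ᶠ x in 𝓝 x₀,
    (IsPositiveFrame (o x) (coordFrame x₀ x) ↔ IsPositiveFrame (o x₀) (coordFrame x₀ x₀))

variable {M : Type*} [TopologicalSpace M] [ChartedSpace (Cm m) M] [IsManifold 𝓘(ℂ, Cm m) ω M]

/-- The differential of a map from a real manifold to a complex manifold. -/
abbrev dmap (m : ℕ) {L : Type*} [TopologicalSpace L] [ChartedSpace (EuclideanSpace ℝ (Fin m)) L]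
    {M : Type*} [TopologicalSpace M] [ChartedSpace (Cm m) M] (f : L → M) (x : L) : TangentSpace (𝓡 m) x →L[ℝ] RTangent m (f x) :=
  mfderiv (𝓡 m) 𝓘(ℝ, Cm m) f x

variable (L) in
/-- An oriented, immersed Lagrangian in `M`: an oriented `m`-manifold `L` with a smooth immersion
`f : L → M` satisfying `f^*ω = 0`. -/
structure OrientedLagrangian (X : HermitianData m M) where
  /-- the immersion -/
  f : L → M
  smooth : ContMDiff (𝓡 m) 𝓘(ℝ, Cm m) ∞ f
  immersion : ∀ x : L, Function.Injective (dmap m f x)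
  lagrangian : ∀ (x : L) (u v : TangentSpace (𝓡 m) x),
    X.kahlerForm (f x) ![dmap m f x u, dmap m f x v] = 0
  /-- the orientation -/
  o : ∀ x : L, Orientation ℝ (TangentSpace (𝓡 m) x) (Fin m)
  orientation : IsManifoldOrientation o

namespace OrientedLagrangian

variable {X : HermitianData m M} (F : OrientedLagrangian L X)

/-- The restriction `Ω|_L`, evaluated on `m` tangent vectors. -/
def omRestrict (x : L) (v : Fin m → TangentSpace (𝓡 m) x) : ℂ :=
  X.OmReal (F.f x) fun i => dmap m F.f x (v i)

open Classical in
/-- The volume form `dV_L` of the induced metric `g|_L` and the orientation, evaluated on `m` tangent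
vectors: it is `√det(g(v_i,v_j))` on positively oriented bases and `-√det(g(v_i,v_j))` on
negatively oriented ones; the determinant vanishes on linearly dependent families. -/
def volForm (x : L) (v : Fin m → TangentSpace (𝓡 m) x) : ℝ :=
  let d := Real.sqrt (Matrix.det (Matrix.of fun i j : Fin m =>
    X.g.inner (F.f x) (dmap m F.f x (v i)) (dmap m F.f x (v j))))
  if IsPositiveFrame (F.o x) v then d else -d

/-- `F` is almost calibrated: for some `φ`, the form `(cos φ Re Ω - sin φ Im Ω)|_L` is positive,
that is, takes positive values on positively oriented bases. -/
def AlmostCalibrated : Prop :=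
  ∃ φ : ℝ, ∀ (x : L) (v : Fin m → TangentSpace (𝓡 m) x), IsPositiveFrame (F.o x) v →
    0 < Real.cos φ * (F.omRestrict x v).re - Real.sin φ * (F.omRestrict x v).im

end OrientedLagrangian

variable (L) in
/-- A graded, immersed Lagrangian: an oriented one with a smooth function `θ : L → ℝ` such that
`Ω|_L = e^{iθ} dV_L`. -/
structure GradedLagrangian (X : HermitianData m M) extends OrientedLagrangian L X where
  /-- the phase function -/
  θ : L → ℝ
  smooth_θ : ContMDiff (𝓡 m) 𝓘(ℝ, ℝ) ∞ θ
  phase : ∀ (x : L) (v : Fin m → TangentSpace (𝓡 m) x),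
    toOrientedLagrangian.omRestrict x v =
      Complex.exp (Complex.I * (θ x : ℂ)) * (toOrientedLagrangian.volForm x v : ℂ)

/-- The phase variation `sup θ - inf θ` of a graded Lagrangian. -/
def GradedLagrangian.phaseVariation {X : HermitianData m M} (F : GradedLagrangian L X) : ℝ :=
  (⨆ x, F.θ x) - ⨅ x, F.θ x

end Lagrangian

end

/-! Where Ω = dw₁ ∧ ⋯ ∧ dw_m for some functions w_j, Ω is exact, so by Stokes the integral of
e^{iα}Ω over a compact L vanishes for every real α. Its real part on L is cos(θ + α) dV. If the
phase variation were at most π, taking -α to be the midpoint of the range of θ would give cos(θ + α)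
≥ 0, hence cos(θ + α) = 0 everywhere. Then θ takes only the values ±π/2 - α and is locally constant.
On the open and closed part where θ = θ(x₀), the choice α = -θ(x₀) turns the integral into a
positive volume, a contradiction. Almost calibrated means cos(θ + φ) > 0, which contradicts the
vanishing at once. Both arguments apply to any nonempty open and closed part A of L that is mapped
into the domain of the w_j, after extending w_j ∘ f by zero off A; this gives (c).

In ℂ^m one takes w_j = z_j. In a Calabi–Yau manifold Ω = h dy₁ ∧ ⋯ ∧ dy_m in a chart, and replacing
y_{i₀} by a holomorphic H with ∂H/∂y_{i₀} = h gives the w_j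
(`HermitianData.IsCalabiYau.exists_isUnimodular`); small Riemannian balls lie in their domain.

Stokes' theorem (`sum_integral_coordDensity_eq_zero`) is proved for this one form, by integrals in
charts weighted by a partition of unity. Locally it is integration by parts, using the symmetry of
second derivatives. The function w_{i₀} carries the cutoffs and may be merely C¹; the others are C².
An index i₀ exists because m ≥ 1. -/

noncomputable section

open MeasureTheory in
/-- A continuous function on an open set that vanishes off a compact subset is integrable. -/
theorem integrableOn_of_eq_zero_off_compact {E F : Type*} [TopologicalSpace E] [T2Space E]
    [MeasurableSpace E] [OpensMeasurableSpace E] {μ : Measure E} [IsFiniteMeasureOnCompacts μ]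
    [NormedAddCommGroup F]
    {O K : Set E} (hO : IsOpen O) (hK : IsCompact K) (hKO : K ⊆ O) {f : E → F}
    (hf : ContinuousOn f O) (h0 : ∀ y ∈ O, y ∉ K → f y = 0) : IntegrableOn f O μ := by
  have h1 : IntegrableOn f K μ := (hf.mono hKO).integrableOn_compact hK
  exact h1.of_forall_sdiff_eq_zero hO.measurableSet fun y hy => h0 y hy.1 hy.2

/-! ### Stokes' theorem on a vector space -/

section EuclideanStokes

variable {ι : Type*} [Fintype ι] [DecidableEq ι]

/-- This is d(dw₂ ∧ ⋯ ∧ dw_m) = 0 in coordinates. For fixed k, composing σ with the transposition of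
i₀ and k reverses the sign and preserves the rest of the term, by the symmetry of S, so the terms
cancel in pairs. -/
theorem sum_sign_mul_sum_prod_symm_eq_zero (i₀ : ι) (a : ι → ι → ℂ) (S : ι → ι → ι → ℂ)
    (hS : ∀ k p q, S k p q = S k q p) :
    ∑ σ : Equiv.Perm ι, ((Equiv.Perm.sign σ : ℤ) : ℂ) * ∑ k ∈ Finset.univ.erase i₀,
      (∏ j ∈ (Finset.univ.erase i₀).erase k, a j (σ j)) * S k (σ i₀) (σ k) = 0 := by
  simp_rw [Finset.mul_sum]
  rw [Finset.sum_comm]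
  refine Finset.sum_eq_zero fun k hk => ?_
  have hk0 : k ≠ i₀ := Finset.ne_of_mem_erase hk
  refine Finset.sum_involution (fun σ _ => σ * Equiv.swap i₀ k) ?_ ?_ ?_ ?_
  · intro σ _
    have h1 : ∏ j ∈ (Finset.univ.erase i₀).erase k, a j ((σ * Equiv.swap i₀ k) j) =
        ∏ j ∈ (Finset.univ.erase i₀).erase k, a j (σ j) := by
      refine Finset.prod_congr rfl fun j hj => ?_
      have hjk : j ≠ k := Finset.ne_of_mem_erase hj
      have hj0 : j ≠ i₀ := Finset.ne_of_mem_erase (Finset.mem_of_mem_erase hj)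
      rw [Equiv.Perm.mul_apply, Equiv.swap_apply_of_ne_of_ne hj0 hjk]
    rw [h1, Equiv.Perm.sign_mul, Equiv.Perm.sign_swap hk0.symm]
    simp only [Equiv.Perm.mul_apply, Equiv.swap_apply_left, Equiv.swap_apply_right]
    rw [hS k (σ k) (σ i₀)]
    push_cast
    ring
  · intro σ _ _ h
    have := congrArg (fun τ : Equiv.Perm ι => τ i₀) h
    simp only [Equiv.Perm.mul_apply, Equiv.swap_apply_left] at this
    exact hk0 (σ.injective this)
  · intro σ _
    exact Finset.mem_univ _
  · intro σ _
    rw [mul_assoc, Equiv.swap_mul_self, mul_one]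

variable {E : Type*} [NormedAddCommGroup E] [NormedSpace ℝ E] [FiniteDimensional ℝ E]
  [MeasurableSpace E] [BorelSpace E]

open MeasureTheory in
/-- Stokes' theorem for `dw₁ ∧ ⋯ ∧ dw_m` on a vector space, where one of the functions `w_j` has
compact support. -/
theorem integral_det_fderiv_eq_zero (μ : Measure E) [μ.IsAddHaarMeasure] (i₀ : ι)
    (w : ι → E → ℂ) (h₀ : ContDiff ℝ 1 (w i₀)) (hc : HasCompactSupport (w i₀))
    (hw : ∀ j, j ≠ i₀ → ContDiff ℝ 2 (w j)) (e : ι → E) :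
    ∫ y, Matrix.det (Matrix.of fun i j => fderiv ℝ (w j) y (e i)) ∂μ = 0 := by
  set P : Equiv.Perm ι → E → ℂ := fun σ y =>
    ∏ j ∈ Finset.univ.erase i₀, fderiv ℝ (w j) y (e (σ j)) with hPdef
  have hg : ∀ j, j ≠ i₀ → ∀ v, ContDiff ℝ 1 (fun y => fderiv ℝ (w j) y v) := fun j hj v =>
    ((hw j hj).fderiv_right (by norm_num)).clm_apply contDiff_const
  have hP : ∀ σ, ContDiff ℝ 1 (P σ) := fun σ =>
    contDiff_prod fun j hj => hg j (Finset.ne_of_mem_erase hj) _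
  have hc' : ∀ v, HasCompactSupport fun y => fderiv ℝ (w i₀) y v := fun v => hc.fderiv_apply ℝ v
  have hcont' : ∀ v, Continuous fun y => fderiv ℝ (w i₀) y v := fun v =>
    (h₀.continuous_fderiv one_ne_zero).clm_apply continuous_const
  have hPf : ∀ σ v, Continuous fun y => fderiv ℝ (P σ) y v := fun σ v =>
    ((hP σ).continuous_fderiv one_ne_zero).clm_apply continuous_const
  have hI1 : ∀ σ v, Integrable (fun y => fderiv ℝ (w i₀) y v * P σ y) μ := fun σ v =>
    ((hcont' v).mul (hP σ).continuous).integrable_of_hasCompactSupport (hc' v).mul_right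
  have hI2 : ∀ σ v, Integrable (fun y => w i₀ y * fderiv ℝ (P σ) y v) μ := fun σ v =>
    (h₀.continuous.mul (hPf σ v)).integrable_of_hasCompactSupport hc.mul_right
  have hI3 : ∀ σ, Integrable (fun y => w i₀ y * P σ y) μ := fun σ =>
    (h₀.continuous.mul (hP σ).continuous).integrable_of_hasCompactSupport hc.mul_right
  have hdet : ∀ y, Matrix.det (Matrix.of fun i j => fderiv ℝ (w j) y (e i)) =
      ∑ σ : Equiv.Perm ι, ((Equiv.Perm.sign σ : ℤ) : ℂ) *
        (fderiv ℝ (w i₀) y (e (σ i₀)) * P σ y) := by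
    intro y
    rw [Matrix.det_apply']
    refine Finset.sum_congr rfl fun σ _ => ?_
    rw [← Finset.mul_prod_erase _ _ (Finset.mem_univ i₀)]
    rfl
  have hder : ∀ σ y v, fderiv ℝ (P σ) y v = ∑ k ∈ Finset.univ.erase i₀,
      (∏ j ∈ (Finset.univ.erase i₀).erase k, fderiv ℝ (w j) y (e (σ j))) *
        fderiv ℝ (fderiv ℝ (w k)) y v (e (σ k)) := by
    intro σ y v
    have h2 : ∀ k ∈ Finset.univ.erase i₀,
        HasFDerivAt (fun y => fderiv ℝ (w k) y (e (σ k)))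
          ((fderiv ℝ (fderiv ℝ (w k)) y).flip (e (σ k))) y := by
      intro k hk
      have hd : DifferentiableAt ℝ (fderiv ℝ (w k)) y :=
        (((hw k (Finset.ne_of_mem_erase hk)).fderiv_right (m := 1)
          (by norm_num)).differentiable one_ne_zero) y
      have := hd.hasFDerivAt.clm_apply (hasFDerivAt_const (e (σ k)) y)
      rwa [ContinuousLinearMap.comp_zero, zero_add] at this
    have h3 := HasFDerivAt.finsetProd h2
    rw [h3.fderiv]
    simp
  have hsymm : ∀ y k, k ≠ i₀ → ∀ u v,
      fderiv ℝ (fderiv ℝ (w k)) y u v = fderiv ℝ (fderiv ℝ (w k)) y v u := by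
    intro y k hk u v
    exact ((hw k hk).contDiffAt.isSymmSndFDerivAt (by simp)).eq u v
  simp_rw [hdet]
  rw [integral_finsetSum _ fun σ _ => (hI1 σ _).const_mul _]
  -- In the Leibniz expansion each term contains one derivative of w i₀, which integration by parts
  -- moves to the product `P σ`. Only second derivatives of the other w j then occur.
  have hparts : ∀ σ : Equiv.Perm ι, ∫ y, ((Equiv.Perm.sign σ : ℤ) : ℂ) *
      (fderiv ℝ (w i₀) y (e (σ i₀)) * P σ y) ∂μ = - ∫ y, ((Equiv.Perm.sign σ : ℤ) : ℂ) *
      (w i₀ y * fderiv ℝ (P σ) y (e (σ i₀))) ∂μ := by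
    intro σ
    rw [integral_const_mul, integral_const_mul, integral_mul_fderiv_eq_neg_fderiv_mul_of_integrable
      (hI1 σ _) (hI2 σ _) (hI3 σ) (fun y _ => h₀.differentiable one_ne_zero y)
      (fun y _ => (hP σ).differentiable one_ne_zero y)]
    ring
  simp_rw [hparts]
  rw [Finset.sum_neg_distrib, ← integral_finsetSum _ fun σ _ => (hI2 σ _).const_mul _,
    neg_eq_zero]
  rw [← integral_zero E ℂ (μ := μ)]
  congr 1
  ext y
  -- The value 0 at k = i₀ is a filler: w i₀ is only C¹, so no symmetry is known there, and this
  -- index does not occur in the sum.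
  have key := sum_sign_mul_sum_prod_symm_eq_zero i₀ (fun j p => fderiv ℝ (w j) y (e p))
    (fun k p q => if k = i₀ then 0 else fderiv ℝ (fderiv ℝ (w k)) y (e p) (e q)) (by
      intro k p q
      split_ifs with h
      · rfl
      · exact hsymm y k h _ _)
  calc _ = w i₀ y * ∑ σ : Equiv.Perm ι, ((Equiv.Perm.sign σ : ℤ) : ℂ) *
        ∑ k ∈ Finset.univ.erase i₀, (∏ j ∈ (Finset.univ.erase i₀).erase k,
          fderiv ℝ (w j) y (e (σ j))) * (if k = i₀ then 0 else
            fderiv ℝ (fderiv ℝ (w k)) y (e (σ i₀)) (e (σ k))) := by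
        rw [Finset.mul_sum]
        refine Finset.sum_congr rfl fun σ _ => ?_
        rw [hder]
        rw [mul_left_comm]
        congr 2
        refine Finset.sum_congr rfl fun k hk => ?_
        rw [if_neg (Finset.ne_of_mem_erase hk)]
    _ = 0 := by rw [key, mul_zero]

open MeasureTheory in
/-- Stokes' theorem for `dw₁ ∧ ⋯ ∧ dw_m` on an open subset of a vector space, where one of the
functions `w_j` has compact support. -/
theorem setIntegral_det_fderiv_eq_zero (μ : Measure E) [μ.IsAddHaarMeasure] (i₀ : ι)
    {O K : Set E} (hO : IsOpen O) (hK : IsCompact K) (hKO : K ⊆ O)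
    (w : ι → E → ℂ) (h₀ : ContDiffOn ℝ 1 (w i₀) O) (hc : ∀ y ∈ O, y ∉ K → w i₀ y = 0)
    (hw : ∀ j, j ≠ i₀ → ContDiffOn ℝ 2 (w j) O) (e : ι → E) :
    ∫ y in O, Matrix.det (Matrix.of fun i j => fderiv ℝ (w j) y (e i)) ∂μ = 0 := by
  obtain ⟨K', hK', hKK', hK'O⟩ := exists_compact_between hK hO hKO
  -- All w j are multiplied by one cutoff ρ, equal to 1 near K and to 0 off K', so that they extend
  -- to the whole space. Near K nothing changes; elsewhere column i₀ is zero both before and after,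
  -- so the determinants agree on O.
  obtain ⟨ρ, hρ1, hρ0, -⟩ := exists_contMDiffMap_one_nhds_of_subset_interior 𝓘(ℝ, E) (n := 2)
    hK.isClosed hKK'
  have hρd : ContDiff ℝ 2 ρ := ρ.contMDiff.contDiff
  have hzero : ∀ y ∉ K', ∀ g : E → ℂ, (fun z => ρ z • g z) =ᶠ[𝓝 y] fun _ => 0 := by
    intro y hy g
    filter_upwards [hK'.isClosed.isOpen_compl.mem_nhds hy] with z hz
    rw [hρ0 z hz, zero_smul]
  have hext : ∀ (g : E → ℂ) (n : ℕ), n ≤ 2 → ContDiffOn ℝ n g O →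
      ContDiff ℝ n fun y => ρ y • g y := by
    intro g n hn hg
    rw [contDiff_iff_contDiffAt]
    intro y
    by_cases hy : y ∈ O
    · exact ((hρd.of_le (by exact_mod_cast hn)).contDiffAt).smul (hg.contDiffAt (hO.mem_nhds hy))
    · exact contDiffAt_const.congr_of_eventuallyEq (hzero y (fun h => hy (hK'O h)) g)
  have hstokes := integral_det_fderiv_eq_zero μ i₀ (fun j y => ρ y • w j y)
    (hext _ 1 (by norm_num) h₀)
    (HasCompactSupport.intro hK' fun y hy => by rw [hρ0 y hy, zero_smul])
    (fun j hj => hext _ 2 le_rfl (hw j hj)) e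
  have hcol : ∀ (u : ι → E → ℂ) (y : E), u i₀ =ᶠ[𝓝 y] (fun _ => 0) →
      Matrix.det (Matrix.of fun i j => fderiv ℝ (u j) y (e i)) = 0 := by
    intro u y hu
    refine Matrix.det_eq_zero_of_column_eq_zero i₀ fun i => ?_
    rw [Matrix.of_apply, hu.fderiv_eq]
    simp
  refine Eq.trans ?_ ((setIntegral_eq_integral_of_forall_compl_eq_zero (s := O) ?_).trans hstokes)
  · refine setIntegral_congr_fun hO.measurableSet fun y hy => ?_
    by_cases hyK : y ∈ K
    · have h1 : ∀ᶠ z in 𝓝 y, ρ z = 1 := hρ1.filter_mono (nhds_le_nhdsSet hyK)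
      have h2 : ∀ j, (fun z => ρ z • w j z) =ᶠ[𝓝 y] w j := fun j => by
        filter_upwards [h1] with z hz
        rw [hz, one_smul]
      have h3 : ∀ j, fderiv ℝ (fun z => ρ z • w j z) y = fderiv ℝ (w j) y := fun j =>
        (h2 j).fderiv_eq
      simp only [h3]
    · have h1 : w i₀ =ᶠ[𝓝 y] fun _ => 0 := by
        filter_upwards [hO.mem_nhds hy, hK.isClosed.isOpen_compl.mem_nhds hyK] with z hz hz'
        exact hc z hz hz'
      refine (hcol w y h1).trans (hcol (fun j y => ρ y • w j y) y ?_).symm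
      filter_upwards [h1] with z hz
      rw [hz, smul_zero]
  · intro y hy
    exact hcol (fun j y => ρ y • w j y) y (hzero y (fun h => hy (hK'O h)) _)

end EuclideanStokes

/-! ### Signs of frames and determinants -/

/-- The sign of a family of `m` vectors with respect to an orientation. -/
def frameSign {V : Type*} [AddCommGroup V] [Module ℝ V] {m : ℕ}
    (o : Orientation ℝ V (Fin m)) (v : Fin m → V) : ℝ :=
  open Classical in if IsPositiveFrame o v then 1 else -1

theorem isPositiveFrame_basis {V : Type*} [AddCommGroup V] [Module ℝ V] {m : ℕ}
    (o : Orientation ℝ V (Fin m)) (b : Module.Basis (Fin m) ℝ V) :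
    IsPositiveFrame o b ↔ b.orientation = o :=
  ⟨fun ⟨b', hb', ho⟩ => by
    rwa [← Module.Basis.eq_of_apply_eq (fun i => congrFun hb' i)], fun h => ⟨b, rfl, h⟩⟩

/-- The sign absorbs the sign of the Jacobian and leaves its absolute value, which is what the
change of variables formula requires. No oriented atlas has to be chosen. -/
theorem frameSign_mul_det {V : Type*} [AddCommGroup V] [Module ℝ V] {m : ℕ}
    (o : Orientation ℝ V (Fin m)) (b b' : Module.Basis (Fin m) ℝ V) :
    frameSign o b' * b.det b' = frameSign o b * |b.det b'| := by
  have hpos := b.orientation_eq_iff_det_pos b'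
  have hneg : b.orientation ≠ b'.orientation → b.det b' < 0 := fun h =>
    lt_of_le_of_ne (not_lt.1 fun hlt => h (hpos.2 hlt)) (b.isUnit_det b').ne_zero
  unfold frameSign
  rw [isPositiveFrame_basis, isPositiveFrame_basis]
  by_cases h : b.orientation = o <;> by_cases h' : b'.orientation = o
  · rw [if_pos h, if_pos h', abs_of_pos (hpos.1 (h.trans h'.symm))]
  · rw [if_pos h, if_neg h', abs_of_neg (hneg fun e => h' (e ▸ h))]
    ring
  · rw [if_neg h, if_pos h', abs_of_neg (hneg fun e => h (e ▸ h'))]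
    ring
  · have e : b.orientation = b'.orientation := by
      have h1 := (b.orientation_ne_iff_eq_neg o).1 (Ne.symm h)
      have h2 := (b'.orientation_ne_iff_eq_neg o).1 (Ne.symm h')
      exact neg_injective (h1.symm.trans h2)
    rw [if_neg h, if_neg h', abs_of_pos (hpos.1 e)]

theorem det_apply_eq_basis_det_mul {V : Type*} [AddCommGroup V] [Module ℝ V] {ι : Type*}
    [Fintype ι] [DecidableEq ι] (b : Module.Basis ι ℝ V) (l : ι → V →ₗ[ℝ] ℂ) (v : ι → V) :
    Matrix.det (Matrix.of fun i j => l j (v i)) =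
      (b.det v : ℂ) * Matrix.det (Matrix.of fun i j => l j (b i)) := by
  have h : (Matrix.of fun i j => l j (v i)) =
      ((b.toMatrix v).map Complex.ofRealHom).transpose * Matrix.of fun i j => l j (b i) := by
    ext i j
    rw [Matrix.mul_apply]
    conv_lhs => rw [Matrix.of_apply, ← b.sum_toMatrix_smul_self v i, map_sum]
    simp
  rw [h, Matrix.det_mul, Matrix.det_transpose, Module.Basis.det_apply]
  congr 1
  exact (Complex.ofRealHom.map_det (b.toMatrix v)).symm

/-! ### Coordinate frames and Jacobians of transition maps -/

section CoordinateFrames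

variable {m : ℕ} {L : Type*} [TopologicalSpace L] [ChartedSpace (EuclideanSpace ℝ (Fin m)) L]
  [IsManifold (𝓡 m) ∞ L]

/-- The frame is defined through a trivialization of the tangent bundle; this form lets derivatives
along it be computed in the chart by the chain rule. -/
theorem coordFrame_eq_mfderiv_symm {a x : L}
    (hx : x ∈ (chartAt (EuclideanSpace ℝ (Fin m)) a).source) (i : Fin m) :
    coordFrame a x i = mfderiv (𝓡 m) (𝓡 m) (chartAt (EuclideanSpace ℝ (Fin m)) a).symm
      (chartAt (EuclideanSpace ℝ (Fin m)) a x) (EuclideanSpace.single i 1) := by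
  have : IsManifold (𝓡 m) 1 L := IsManifold.of_le (n := ∞) (by norm_num)
  unfold coordFrame
  rw [TangentBundle.symmL_trivializationAt hx]
  simp [mfderivWithin_univ]
  rfl

theorem mfderiv_coordFrame {F : Type*} [NormedAddCommGroup F] [NormedSpace ℝ F] {a x : L}
    (hx : x ∈ (chartAt (EuclideanSpace ℝ (Fin m)) a).source) {g : L → F}
    (hg : MDifferentiableAt (𝓡 m) 𝓘(ℝ, F) g x) (i : Fin m) :
    mfderiv (𝓡 m) 𝓘(ℝ, F) g x (coordFrame a x i) =
      fderiv ℝ (g ∘ (chartAt (EuclideanSpace ℝ (Fin m)) a).symm)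
        (chartAt (EuclideanSpace ℝ (Fin m)) a x) (EuclideanSpace.single i 1) := by
  have hφ := (mdifferentiableAt_atlas_symm (I := 𝓡 m) (chart_mem_atlas (EuclideanSpace ℝ (Fin m)) a)
    ((chartAt (EuclideanSpace ℝ (Fin m)) a).map_source hx))
  have hx' := (chartAt (EuclideanSpace ℝ (Fin m)) a).left_inv hx
  rw [coordFrame_eq_mfderiv_symm hx, ← mfderiv_eq_fderiv]
  have := mfderiv_comp_of_eq (x := chartAt (EuclideanSpace ℝ (Fin m)) a x) hg hφ hx'
  -- The base points x and φ⁻¹(φ x) are equal only propositionally, so the point is generalised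
  -- before comparing derivatives.
  have key : ∀ z, z = x → ∀ u : EuclideanSpace ℝ (Fin m),
      mfderiv (𝓡 m) 𝓘(ℝ, F) g x u = mfderiv (𝓡 m) 𝓘(ℝ, F) g z u := by
    rintro _ rfl _
    rfl
  exact (key _ hx' _).trans (DFunLike.congr_fun this (EuclideanSpace.single i (1 : ℝ))).symm

/-- The coordinate frame of the chart at `a` as a basis of the tangent space at `x`. -/
def coordBasis (a x : L) (hx : x ∈ (chartAt (EuclideanSpace ℝ (Fin m)) a).source) :
    Module.Basis (Fin m) ℝ (TangentSpace (𝓡 m) x) :=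
  (EuclideanSpace.basisFun (Fin m) ℝ).toBasis.map
    ((trivializationAt (EuclideanSpace ℝ (Fin m)) (TangentSpace (𝓡 m)) a).continuousLinearEquivAt
      ℝ x hx).symm.toLinearEquiv

theorem coe_coordBasis (a x : L) (hx : x ∈ (chartAt (EuclideanSpace ℝ (Fin m)) a).source) :
    ⇑(coordBasis a x hx) = coordFrame a x := by
  ext1 i
  have h := (trivializationAt (EuclideanSpace ℝ (Fin m))
    (TangentSpace (𝓡 m)) a).symm_continuousLinearEquivAt_eq (R := ℝ) hx
  have h1 : coordBasis a x hx i = ((trivializationAt (EuclideanSpace ℝ (Fin m))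
      (TangentSpace (𝓡 m)) a).continuousLinearEquivAt ℝ x hx).symm (EuclideanSpace.single i 1) := by
    rw [coordBasis, Module.Basis.map_apply]
    simp
  rw [h1]
  exact congrFun h _

theorem coordBasis_repr (b x : L) (hb : x ∈ (chartAt (EuclideanSpace ℝ (Fin m)) b).source)
    (v : TangentSpace (𝓡 m) x) (u : EuclideanSpace ℝ (Fin m))
    (huv : mfderiv (𝓡 m) (𝓡 m) (chartAt (EuclideanSpace ℝ (Fin m)) b) x v = u) (k : Fin m) :
    (coordBasis b x hb).repr v k = u k := by
  have : IsManifold (𝓡 m) 1 L := IsManifold.of_le (n := ∞) (by norm_num)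
  have h := TangentBundle.continuousLinearMapAt_trivializationAt (I := 𝓡 m) (𝕜 := ℝ) hb
  have h1 : (coordBasis b x hb).repr v k =
      ((trivializationAt (EuclideanSpace ℝ (Fin m)) (TangentSpace (𝓡 m)) b).continuousLinearEquivAt
        ℝ x hb v : EuclideanSpace ℝ (Fin m)) k := by
    rw [coordBasis, Module.Basis.map_repr]
    rfl
  rw [h1, ← huv]
  have h2 := congrFun ((trivializationAt (EuclideanSpace ℝ (Fin m))
    (TangentSpace (𝓡 m)) b).coe_continuousLinearEquivAt_eq (R := ℝ) hb) v
  exact congrArg (fun w : EuclideanSpace ℝ (Fin m) => w k)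
    (h2.trans (DFunLike.congr_fun h v))

theorem coordBasis_det (a b x : L) (ha : x ∈ (chartAt (EuclideanSpace ℝ (Fin m)) a).source)
    (hb : x ∈ (chartAt (EuclideanSpace ℝ (Fin m)) b).source) :
    (coordBasis b x hb).det (coordFrame a x) =
      (fderiv ℝ (chartAt (EuclideanSpace ℝ (Fin m)) b ∘ (chartAt (EuclideanSpace ℝ (Fin m)) a).symm)
        (chartAt (EuclideanSpace ℝ (Fin m)) a x)).det := by
  have hφ : MDifferentiableAt (𝓡 m) (𝓡 m) (chartAt (EuclideanSpace ℝ (Fin m)) b) x :=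
    mdifferentiableAt_atlas (I := 𝓡 m) (chart_mem_atlas (EuclideanSpace ℝ (Fin m)) b) hb
  rw [ContinuousLinearMap.det, ← LinearMap.det_toMatrix (EuclideanSpace.basisFun (Fin m) ℝ).toBasis,
    Module.Basis.det_apply]
  congr 1
  ext k i
  rw [Module.Basis.toMatrix_apply, coordBasis_repr b x hb _ _ (mfderiv_coordFrame ha hφ i),
    LinearMap.toMatrix_apply]
  simp

end CoordinateFrames

/-! ### Densities and their integrals in charts -/

section ChartIntegrals

variable {m : ℕ} {L : Type*} [TopologicalSpace L] [ChartedSpace (EuclideanSpace ℝ (Fin m)) L]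

local notation "φ" => chartAt (EuclideanSpace ℝ (Fin m))

/-- The image of `U` under the chart at `a`. -/
def chartImage (a : L) (U : Set L) : Set (EuclideanSpace ℝ (Fin m)) :=
  (φ a).target ∩ (φ a).symm ⁻¹' U

theorem isOpen_chartImage (a : L) {U : Set L} (hU : IsOpen U) :
    IsOpen (chartImage (m := m) a U) :=
  (φ a).isOpen_inter_preimage_symm hU

variable (m) in
/-- The differential of a complex valued function. -/
def cdiff (g : L → ℂ) (x : L) : TangentSpace (𝓡 m) x →L[ℝ] ℂ := mfderiv (𝓡 m) 𝓘(ℝ, ℂ) g x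

theorem cdiff_congr {g g' : L → ℂ} {x : L} (h : g =ᶠ[𝓝 x] g') : cdiff m g x = cdiff m g' x :=
  h.mfderiv_eq

theorem cdiff_zero (x : L) : cdiff m (fun _ => (0 : ℂ)) x = 0 :=
  mfderiv_const

theorem cdiff_sum {ι : Type*} (s : Finset ι) (g : ι → L → ℂ) (x : L)
    (hg : ∀ b ∈ s, MDifferentiableAt (𝓡 m) 𝓘(ℝ, ℂ) (g b) x) :
    cdiff m (fun x => ∑ b ∈ s, g b x) x = ∑ b ∈ s, cdiff m (g b) x := by
  classical
  suffices h : HasMFDerivAt (𝓡 m) 𝓘(ℝ, ℂ) (fun x => ∑ b ∈ s, g b x) x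
      (∑ b ∈ s, cdiff m (g b) x : TangentSpace (𝓡 m) x →L[ℝ] ℂ) from h.mfderiv
  induction s using Finset.induction_on with
  | empty =>
    simp only [Finset.sum_empty]
    exact hasMFDerivAt_const (I := 𝓡 m) (I' := 𝓘(ℝ, ℂ)) (0 : ℂ) x
  | insert b s hb ih =>
    have h1 := (hg b (Finset.mem_insert_self b s)).hasMFDerivAt
    have h2 := ih fun c hc => hg c (Finset.mem_insert_of_mem hc)
    have h3 := HasMFDerivAt.add (f' := cdiff m (g b) x) h1 h2
    have h4 : (fun x => ∑ b ∈ insert b s, g b x) = g b + fun x => ∑ b ∈ s, g b x := by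
      ext y
      rw [Finset.sum_insert hb, Pi.add_apply]
    rw [Finset.sum_insert hb, h4]
    exact h3

variable [IsManifold (𝓡 m) ∞ L]

theorem contDiffOn_comp_chart_symm {F : Type*} [NormedAddCommGroup F] [NormedSpace ℝ F]
    {n : WithTop ℕ∞} (hn : n ≤ ∞) {g : L → F} (hg : ContMDiff (𝓡 m) 𝓘(ℝ, F) n g) (a : L) :
    ContDiffOn ℝ n (g ∘ (φ a).symm) (φ a).target := by
  have : IsManifold (𝓡 m) n L := IsManifold.of_le (n := ∞) hn
  rw [← contMDiffOn_iff_contDiffOn]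
  exact hg.comp_contMDiffOn (contMDiffOn_chart_symm (n := n))

/-- The value of `dw₁ ∧ ⋯ ∧ dw_m` on the coordinate frame of the chart at `a`, up to the sign of the
frame. -/
def coordDensity (o : ∀ x : L, Orientation ℝ (TangentSpace (𝓡 m) x) (Fin m))
    (w : Fin m → L → ℂ) (a x : L) : ℂ :=
  (frameSign (o x) (coordFrame a x) : ℂ) *
    Matrix.det (Matrix.of fun i j => cdiff m (w j) x (coordFrame a x i))

variable (o : ∀ x : L, Orientation ℝ (TangentSpace (𝓡 m) x) (Fin m))

/-- The determinant scales by the Jacobian of the transition map, and `frameSign_mul_det` makes this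
an absolute value. -/
theorem coordDensity_change (w : Fin m → L → ℂ) {a b x : L} (ha : x ∈ (φ a).source)
    (hb : x ∈ (φ b).source) :
    coordDensity o w a x =
      |(fderiv ℝ (φ b ∘ (φ a).symm) (φ a x)).det| • coordDensity o w b x := by
  have h1 := det_apply_eq_basis_det_mul (coordBasis b x hb)
    (fun j => (cdiff m (w j) x).toLinearMap) (coordFrame a x)
  have h2 := frameSign_mul_det (o x) (coordBasis b x hb) (coordBasis a x ha)
  rw [coe_coordBasis, coe_coordBasis, coordBasis_det a b x ha hb] at h2
  rw [coe_coordBasis, coordBasis_det a b x ha hb] at h1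
  have h2' := congrArg (Complex.ofReal) h2
  simp only [Complex.ofReal_mul] at h2'
  simp only [ContinuousLinearMap.coe_coe] at h1
  rw [coordDensity, coordDensity, h1, ← mul_assoc, h2', Complex.real_smul]
  ring

theorem coordDensity_symm {w : Fin m → L → ℂ} (hw : ∀ j, MDifferentiable (𝓡 m) 𝓘(ℝ, ℂ) (w j))
    {a : L} {y : EuclideanSpace ℝ (Fin m)} (hy : y ∈ (φ a).target) :
    coordDensity o w a ((φ a).symm y) =
      (frameSign (o ((φ a).symm y)) (coordFrame a ((φ a).symm y)) : ℂ) *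
        Matrix.det (Matrix.of fun i j =>
          fderiv ℝ (w j ∘ (φ a).symm) y (EuclideanSpace.single i 1)) := by
  rw [coordDensity]
  congr 3
  ext i j
  have := mfderiv_coordFrame ((φ a).map_target hy) (hw j ((φ a).symm y)) i
  rw [(φ a).right_inv hy] at this
  exact this

theorem coordDensity_eq_zero {w : Fin m → L → ℂ} {a x : L} {j : Fin m}
    (h : w j =ᶠ[𝓝 x] fun _ => 0) : coordDensity o w a x = 0 := by
  rw [coordDensity, Matrix.det_eq_zero_of_column_eq_zero j, mul_zero]
  intro i
  rw [Matrix.of_apply, cdiff_congr h, cdiff_zero]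
  rfl

/-- A neighbourhood of `a` in the domain of the chart at `a` on which the sign of the coordinate
frame is constant. -/
structure IsSignChart (a : L) (U : Set L) : Prop where
  isOpen : IsOpen U
  subset : U ⊆ (φ a).source
  sign : ∀ x ∈ U, frameSign (o x) (coordFrame a x) = frameSign (o a) (coordFrame a a)

variable {o}

theorem IsManifoldOrientation.exists_isSignChart (ho : IsManifoldOrientation o) (a : L) :
    ∃ U, a ∈ U ∧ IsSignChart o a U := by
  obtain ⟨V, hV, hVo, haV⟩ := eventually_nhds_iff.1 (ho a)
  refine ⟨V ∩ (φ a).source, ⟨haV, mem_chart_source _ a⟩, hVo.inter (φ a).open_source,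
    inter_subset_right, fun x hx => ?_⟩
  unfold frameSign
  by_cases h : IsPositiveFrame (o a) (coordFrame a a)
  · rw [if_pos h, if_pos ((hV x hx.1).2 h)]
  · rw [if_neg h, if_neg fun h' => h ((hV x hx.1).1 h')]

-- Both integrands vanish off the overlap of U and V, where the transition map is an injective
-- change of variables and `coordDensity_change` supplies its Jacobian factor.
open MeasureTheory in
theorem setIntegral_coordDensity_change (w : Fin m → L → ℂ) (ψ : L → ℂ) {a b : L} {U V : Set L}
    (hU : IsSignChart o a U) (hV : IsSignChart o b V)
    (h1 : ∀ x ∈ U, x ∉ V → ψ x * coordDensity o w a x = 0)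
    (h2 : ∀ x ∈ V, x ∉ U → ψ x * coordDensity o w b x = 0) :
    ∫ y in chartImage (m := m) a U, ψ ((φ a).symm y) * coordDensity o w a ((φ a).symm y) =
      ∫ y in chartImage (m := m) b V, ψ ((φ b).symm y) * coordDensity o w b ((φ b).symm y) := by
  have hUV := hU.isOpen.inter hV.isOpen
  have e1 : ∫ y in chartImage (m := m) a (U ∩ V),
      ψ ((φ a).symm y) * coordDensity o w a ((φ a).symm y) =
      ∫ y in chartImage (m := m) a U, ψ ((φ a).symm y) * coordDensity o w a ((φ a).symm y) := by
    symm
    refine setIntegral_eq_of_subset_of_forall_sdiff_eq_zero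
      (isOpen_chartImage a hU.isOpen).measurableSet (fun y hy => ⟨hy.1, hy.2.1⟩) ?_
    intro y hy
    refine h1 _ hy.1.2 fun h => hy.2 ?_
    exact ⟨hy.1.1, hy.1.2, h⟩
  have e2 : ∫ y in chartImage (m := m) b (U ∩ V),
      ψ ((φ b).symm y) * coordDensity o w b ((φ b).symm y) =
      ∫ y in chartImage (m := m) b V, ψ ((φ b).symm y) * coordDensity o w b ((φ b).symm y) := by
    symm
    refine setIntegral_eq_of_subset_of_forall_sdiff_eq_zero
      (isOpen_chartImage b hV.isOpen).measurableSet (fun y hy => ⟨hy.1, hy.2.2⟩) ?_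
    intro y hy
    refine h2 _ hy.1.2 fun h => hy.2 ?_
    exact ⟨hy.1.1, h, hy.1.2⟩
  have himg : chartImage (m := m) b (U ∩ V) =
      (φ b ∘ (φ a).symm) '' chartImage (m := m) a (U ∩ V) := by
    ext z
    constructor
    · rintro ⟨hz, hz'⟩
      have hs : (φ b).symm z ∈ (φ a).source := hU.subset hz'.1
      refine ⟨φ a ((φ b).symm z), ⟨(φ a).map_source hs, ?_⟩, ?_⟩
      · rw [mem_preimage, (φ a).left_inv hs]
        exact hz'
      · rw [Function.comp_apply, (φ a).left_inv hs, (φ b).right_inv hz]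
    · rintro ⟨y, ⟨hy, hy'⟩, rfl⟩
      have hs : (φ a).symm y ∈ (φ b).source := hV.subset hy'.2
      refine ⟨(φ b).map_source hs, ?_⟩
      rw [mem_preimage, Function.comp_apply, (φ b).left_inv hs]
      exact hy'
  rw [← e1, ← e2, himg, integral_image_eq_integral_abs_det_fderiv_smul volume
    (f' := fun y => fderiv ℝ (φ b ∘ (φ a).symm) y) (isOpen_chartImage a hUV).measurableSet]
  · refine setIntegral_congr_fun (isOpen_chartImage a hUV).measurableSet fun y hy => ?_
    have hs : (φ a).symm y ∈ (φ b).source := hV.subset hy.2.2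
    have := coordDensity_change o w (hU.subset hy.2.1) hs
    rw [(φ a).right_inv hy.1] at this
    simp only [Function.comp_apply]
    rw [(φ b).left_inv hs, this, mul_smul_comm]
  · intro y hy
    have hs : (φ a).symm y ∈ (φ b).source := hV.subset hy.2.2
    have hd : MDifferentiableAt (𝓡 m) (𝓡 m) (φ b ∘ (φ a).symm) y :=
      (mdifferentiableAt_atlas (I := 𝓡 m) (chart_mem_atlas _ b) hs).comp y
        (mdifferentiableAt_atlas_symm (I := 𝓡 m) (chart_mem_atlas _ a) hy.1)
    exact hd.differentiableAt.hasFDerivAt.hasFDerivWithinAt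
  · intro y hy z hz hyz
    have hsy : (φ a).symm y ∈ (φ b).source := hV.subset hy.2.2
    have hsz : (φ a).symm z ∈ (φ b).source := hV.subset hz.2.2
    exact (φ a).symm.injOn hy.1 hz.1 ((φ b).injOn hsy hsz hyz)

theorem continuousOn_coordDensity {w : Fin m → L → ℂ}
    (hw : ∀ j, ContMDiff (𝓡 m) 𝓘(ℝ, ℂ) 1 (w j)) {a : L} {U : Set L} (hU : IsSignChart o a U) :
    ContinuousOn (fun y => coordDensity o w a ((φ a).symm y)) (chartImage (m := m) a U) := by
  have h : ContinuousOn (fun y => (frameSign (o a) (coordFrame a a) : ℂ) *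
      Matrix.det (Matrix.of fun i j => fderiv ℝ (w j ∘ (φ a).symm) y (EuclideanSpace.single i 1)))
      (chartImage (m := m) a U) := by
    refine continuousOn_const.mul ?_
    have hc : ∀ i j, ContinuousOn (fun y => fderiv ℝ (w j ∘ (φ a).symm) y
        (EuclideanSpace.single i 1)) (chartImage (m := m) a U) := fun i j =>
      (((contDiffOn_comp_chart_symm (by norm_num) (hw j) a).mono
        inter_subset_left).continuousOn_fderiv_of_isOpen (isOpen_chartImage a hU.isOpen)
          le_rfl).clm_apply continuousOn_const
    simp only [Matrix.det_apply, Matrix.of_apply]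
    refine continuousOn_finsetSum _ fun σ _ => ?_
    exact (continuousOn_finsetProd _ fun i _ => hc _ _).const_smul _
  refine h.congr fun y hy => ?_
  simp only
  rw [coordDensity_symm o (fun j => (hw j).mdifferentiable one_ne_zero) hy.1, hU.sign _ hy.2]

theorem isCompact_chart_image {a : L} {U K : Set L} (hU : IsSignChart o a U) (hK : IsCompact K)
    (hKU : K ⊆ U) : IsCompact (φ a '' K) ∧ φ a '' K ⊆ chartImage (m := m) a U ∧
      ∀ y ∈ chartImage (m := m) a U, y ∉ φ a '' K → (φ a).symm y ∉ K := by
  refine ⟨hK.image_of_continuousOn ((φ a).continuousOn.mono (hKU.trans hU.subset)), ?_, ?_⟩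
  · rintro _ ⟨x, hx, rfl⟩
    have hs := hU.subset (hKU hx)
    refine ⟨(φ a).map_source hs, ?_⟩
    rw [mem_preimage, (φ a).left_inv hs]
    exact hKU hx
  · intro y hy hyK hx
    exact hyK ⟨_, hx, (φ a).right_inv hy.1⟩

-- The frame sign is constant on U and comes out of the integral, leaving the Euclidean Stokes
-- theorem on the chart image.
open MeasureTheory in
theorem setIntegral_coordDensity_eq_zero {w : Fin m → L → ℂ} (i₀ : Fin m)
    (hw : ∀ j, ContMDiff (𝓡 m) 𝓘(ℝ, ℂ) 1 (w j))
    (hw' : ∀ j, j ≠ i₀ → ContMDiff (𝓡 m) 𝓘(ℝ, ℂ) 2 (w j))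
    {a : L} {U K : Set L} (hU : IsSignChart o a U) (hK : IsCompact K) (hKU : K ⊆ U)
    (h0 : ∀ x ∉ K, w i₀ x = 0) :
    ∫ y in chartImage (m := m) a U, coordDensity o w a ((φ a).symm y) = 0 := by
  obtain ⟨hK1, hK2, hK3⟩ := isCompact_chart_image hU hK hKU
  have hO := isOpen_chartImage (m := m) a hU.isOpen
  have h := setIntegral_det_fderiv_eq_zero volume i₀ hO hK1 hK2 (fun j => w j ∘ (φ a).symm)
    ((contDiffOn_comp_chart_symm (by norm_num) (hw i₀) a).mono inter_subset_left)
    (fun y hy hyK => h0 _ (hK3 y hy hyK))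
    (fun j hj => (contDiffOn_comp_chart_symm
      ENat.LEInfty.out (hw' j hj) a).mono inter_subset_left)
    (fun i => EuclideanSpace.single i 1)
  rw [← mul_zero (frameSign (o a) (coordFrame a a) : ℂ), ← h, ← integral_const_mul]
  refine setIntegral_congr_fun hO.measurableSet fun y hy => ?_
  rw [coordDensity_symm o (fun j => (hw j).mdifferentiable one_ne_zero) hy.1, hU.sign _ hy.2]

end ChartIntegrals

/-! ### Stokes' theorem on a compact oriented manifold -/

section Stokes

variable {m : ℕ} {L : Type*} [TopologicalSpace L] [ChartedSpace (EuclideanSpace ℝ (Fin m)) L]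
  [IsManifold (𝓡 m) ∞ L]

local notation "φ" => chartAt (EuclideanSpace ℝ (Fin m))

/-- The form dw₁ ∧ ⋯ ∧ dw_m is linear in the slot i₀. `Matrix.cramer` expresses the determinant as a
linear map of the replaced column, through which the sum passes. -/
theorem coordDensity_sum_update (o : ∀ x : L, Orientation ℝ (TangentSpace (𝓡 m) x) (Fin m))
    {κ : Type*} (s : Finset κ) (w : Fin m → L → ℂ) (i₀ : Fin m) (g : κ → L → ℂ)
    (hg : ∀ b ∈ s, MDifferentiable (𝓡 m) 𝓘(ℝ, ℂ) (g b)) (hsum : ∀ x, ∑ b ∈ s, g b x = w i₀ x)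
    (a x : L) :
    ∑ b ∈ s, coordDensity o (Function.update w i₀ (g b)) a x = coordDensity o w a x := by
  set M : Matrix (Fin m) (Fin m) ℂ := Matrix.of fun i j => cdiff m (w j) x (coordFrame a x i) with hM
  have h1 : ∀ b, (Matrix.of fun i j =>
      cdiff m (Function.update w i₀ (g b) j) x (coordFrame a x i)) =
      M.updateCol i₀ fun i => cdiff m (g b) x (coordFrame a x i) := by
    intro b
    ext i j
    by_cases hj : j = i₀
    · subst hj
      simp
    · simp [hj, hM]
  have h2 : ∑ b ∈ s, (fun i => cdiff m (g b) x (coordFrame a x i)) = fun i => M i i₀ := by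
    ext i
    have h3 : (fun x => ∑ b ∈ s, g b x) = w i₀ := funext hsum
    rw [Finset.sum_apply, hM, Matrix.of_apply, ← h3, cdiff_sum s g x fun b hb => hg b hb x,
      sum_apply]
  simp only [coordDensity]
  rw [← Finset.mul_sum]
  congr 1
  simp only [h1, ← Matrix.cramer_apply]
  rw [← Finset.sum_apply, ← map_sum, h2, Matrix.cramer_apply]
  congr 1
  exact Matrix.updateCol_eq_self M i₀

variable {o : ∀ x : L, Orientation ℝ (TangentSpace (𝓡 m) x) (Fin m)}

open MeasureTheory in
theorem integrableOn_mul_coordDensity [CompactSpace L] {w : Fin m → L → ℂ}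
    (hw : ∀ j, ContMDiff (𝓡 m) 𝓘(ℝ, ℂ) 1 (w j)) {a : L} {U : Set L} (hU : IsSignChart o a U)
    {χ : L → ℝ} (hχ : Continuous χ) (hχU : tsupport χ ⊆ U) :
    ContinuousOn (fun y => (χ ((φ a).symm y) : ℂ) * coordDensity o w a ((φ a).symm y))
      (chartImage (m := m) a U) ∧
    IntegrableOn (fun y => (χ ((φ a).symm y) : ℂ) * coordDensity o w a ((φ a).symm y))
      (chartImage (m := m) a U) := by
  obtain ⟨hK1, hK2, hK3⟩ := isCompact_chart_image hU (isClosed_tsupport χ).isCompact hχU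
  have hc : ContinuousOn (fun y => (χ ((φ a).symm y) : ℂ) * coordDensity o w a ((φ a).symm y))
      (chartImage (m := m) a U) :=
    (Complex.continuous_ofReal.comp_continuousOn (hχ.comp_continuousOn
      ((φ a).continuousOn_symm.mono inter_subset_left))).mul (continuousOn_coordDensity hw hU)
  refine ⟨hc, integrableOn_of_eq_zero_off_compact (isOpen_chartImage a hU.isOpen) hK1 hK2 hc ?_⟩
  intro y hy hyK
  rw [image_eq_zero_of_notMem_tsupport (hK3 y hy hyK), Complex.ofReal_zero, zero_mul]

open MeasureTheory in
/-- Stokes' theorem: the integral of `dw₁ ∧ ⋯ ∧ dw_m` over a compact oriented manifold, computed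
with a partition of unity, is zero. -/
theorem sum_integral_coordDensity_eq_zero [CompactSpace L]
    {κ : Type*} [Fintype κ] {c : κ → L} {U : κ → Set L} (hU : ∀ k, IsSignChart o (c k) (U k))
    {χ : κ → L → ℝ} (hχ : ∀ k, ContMDiff (𝓡 m) 𝓘(ℝ, ℝ) ∞ (χ k)) (hχU : ∀ k, tsupport (χ k) ⊆ U k)
    (hχ1 : ∀ x, ∑ k, χ k x = 1) {w : Fin m → L → ℂ} (i₀ : Fin m)
    (hw : ∀ j, ContMDiff (𝓡 m) 𝓘(ℝ, ℂ) 1 (w j))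
    (hw' : ∀ j, j ≠ i₀ → ContMDiff (𝓡 m) 𝓘(ℝ, ℂ) 2 (w j)) :
    ∑ k, ∫ y in chartImage (m := m) (c k) (U k), (χ k ((φ (c k)).symm y) : ℂ) *
      coordDensity o w (c k) ((φ (c k)).symm y) = 0 := by
  -- The partition of unity is used twice: once to define the integral, and once to split w i₀ into
  -- pieces χ b • w i₀ supported in single charts. The piece b is moved from every chart to chart b,
  -- where the weights χ k sum to 1 and local Stokes applies.
  set g : κ → L → ℂ := fun b x => χ b x • w i₀ x with hg
  have hgC : ∀ b, ContMDiff (𝓡 m) 𝓘(ℝ, ℂ) 1 (g b) := fun b =>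
    ((hχ b).of_le ENat.LEInfty.out).smul (hw i₀)
  set W : κ → Fin m → L → ℂ := fun b => Function.update w i₀ (g b) with hWdef
  have hW : ∀ b j, ContMDiff (𝓡 m) 𝓘(ℝ, ℂ) 1 (W b j) := by
    intro b j
    by_cases hj : j = i₀
    · subst hj
      simpa [hWdef] using hgC b
    · simpa [hWdef, hj] using hw j
  have hW' : ∀ b j, j ≠ i₀ → ContMDiff (𝓡 m) 𝓘(ℝ, ℂ) 2 (W b j) := by
    intro b j hj
    simpa [hWdef, hj] using hw' j hj
  have hsum : ∀ a x, ∑ b, coordDensity o (W b) a x = coordDensity o w a x := fun a x =>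
    coordDensity_sum_update o Finset.univ w i₀ g
      (fun b _ => (hgC b).mdifferentiable one_ne_zero)
      (fun x => by rw [hg, ← Finset.sum_smul, hχ1, one_smul]) a x
  have hW0 : ∀ b a x, x ∉ tsupport (χ b) → coordDensity o (W b) a x = 0 := by
    intro b a x hx
    refine coordDensity_eq_zero o (j := i₀) ?_
    filter_upwards [(isClosed_tsupport (χ b)).isOpen_compl.mem_nhds hx] with z hz
    simp [hWdef, hg, image_eq_zero_of_notMem_tsupport hz]
  have hint : ∀ b k, IntegrableOn (fun y => (χ k ((φ (c k)).symm y) : ℂ) *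
      coordDensity o (W b) (c k) ((φ (c k)).symm y)) (chartImage (m := m) (c k) (U k)) := fun b k =>
    (integrableOn_mul_coordDensity (hW b) (hU k) (hχ k).continuous (hχU k)).2
  have hchange : ∀ b k, ∫ y in chartImage (m := m) (c k) (U k), (χ k ((φ (c k)).symm y) : ℂ) *
      coordDensity o (W b) (c k) ((φ (c k)).symm y) =
      ∫ y in chartImage (m := m) (c b) (U b), (χ k ((φ (c b)).symm y) : ℂ) *
      coordDensity o (W b) (c b) ((φ (c b)).symm y) := by
    intro b k
    refine setIntegral_coordDensity_change (W b) (fun x => (χ k x : ℂ)) (hU k) (hU b) ?_ ?_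
    · intro x _ hx
      rw [hW0 b _ x fun h => hx (hχU b h), mul_zero]
    · intro x _ hx
      rw [image_eq_zero_of_notMem_tsupport (f := χ k) fun h => hx (hχU k h), Complex.ofReal_zero,
        zero_mul]
  -- Here χ k need not be supported in U b; integrability comes from the support of the piece `W b`.
  have hint' : ∀ b k, IntegrableOn (fun y => (χ k ((φ (c b)).symm y) : ℂ) *
      coordDensity o (W b) (c b) ((φ (c b)).symm y)) (chartImage (m := m) (c b) (U b)) := by
    intro b k
    obtain ⟨hK1, hK2, hK3⟩ := isCompact_chart_image (hU b) (isClosed_tsupport (χ b)).isCompact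
      (hχU b)
    refine integrableOn_of_eq_zero_off_compact (isOpen_chartImage _ (hU b).isOpen) hK1 hK2
      ((Complex.continuous_ofReal.comp_continuousOn ((hχ k).continuous.comp_continuousOn
        ((φ (c b)).continuousOn_symm.mono inter_subset_left))).mul
          (continuousOn_coordDensity (hW b) (hU b))) ?_
    intro y hy hyK
    rw [hW0 b _ _ (hK3 y hy hyK), mul_zero]
  calc _ = ∑ k, ∑ b, ∫ y in chartImage (m := m) (c k) (U k), (χ k ((φ (c k)).symm y) : ℂ) *
        coordDensity o (W b) (c k) ((φ (c k)).symm y) := by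
        refine Finset.sum_congr rfl fun k _ => ?_
        rw [← integral_finsetSum _ fun b _ => hint b k]
        simp_rw [← Finset.mul_sum, hsum]
    _ = ∑ b, ∑ k, ∫ y in chartImage (m := m) (c b) (U b), (χ k ((φ (c b)).symm y) : ℂ) *
        coordDensity o (W b) (c b) ((φ (c b)).symm y) := by
        rw [Finset.sum_comm]
        simp_rw [hchange]
    _ = ∑ b, ∫ y in chartImage (m := m) (c b) (U b),
        coordDensity o (W b) (c b) ((φ (c b)).symm y) := by
        refine Finset.sum_congr rfl fun b _ => ?_
        rw [← integral_finsetSum _ fun k _ => hint' b k]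
        simp_rw [← Finset.sum_mul, ← Complex.ofReal_sum, hχ1, Complex.ofReal_one, one_mul]
    _ = 0 := by
        refine Finset.sum_eq_zero fun b _ => ?_
        refine setIntegral_coordDensity_eq_zero i₀ (hW b) (hW' b) (hU b)
          (isClosed_tsupport (χ b)).isCompact (hχU b) fun x hx => ?_
        simp [hWdef, hg, image_eq_zero_of_notMem_tsupport hx]

open MeasureTheory in
/-- On a compact oriented manifold, if the real part of the constant multiple `c • dw₁ ∧ ⋯ ∧ dw_m`
is nowhere negative, then it vanishes identically. -/
theorem exists_linearIndependent_re_det_cdiff_eq_zero [CompactSpace L] [T2Space L]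
    (ho : IsManifoldOrientation o) {w : Fin m → L → ℂ} (i₀ : Fin m)
    (hw : ∀ j, ContMDiff (𝓡 m) 𝓘(ℝ, ℂ) 1 (w j))
    (hw' : ∀ j, j ≠ i₀ → ContMDiff (𝓡 m) 𝓘(ℝ, ℂ) 2 (w j)) (z : ℂ)
    (hpos : ∀ (x : L) (v : Fin m → TangentSpace (𝓡 m) x), 0 ≤ frameSign (o x) v *
      (z * Matrix.det (Matrix.of fun i j => cdiff m (w j) x (v i))).re) (x : L) :
    ∃ v : Fin m → TangentSpace (𝓡 m) x, LinearIndependent ℝ v ∧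
      (z * Matrix.det (Matrix.of fun i j => cdiff m (w j) x (v i))).re = 0 := by
  choose U haU hU using fun a => ho.exists_isSignChart a
  obtain ⟨t, ht⟩ := isCompact_univ.elim_nhds_subcover U fun a _ => (hU a).isOpen.mem_nhds (haU a)
  obtain ⟨χ, hχ⟩ := SmoothPartitionOfUnity.exists_isSubordinate (𝓡 m) (isClosed_univ (X := L))
    (fun k : t => U k) (fun k => (hU k).isOpen) (fun x _ => by
      obtain ⟨a, ha, hxa⟩ := mem_iUnion₂.1 (ht.2 (mem_univ x))
      exact mem_iUnion.2 ⟨⟨a, ha⟩, hxa⟩)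
  have hχ1 : ∀ x, ∑ k, χ k x = 1 := fun x => by
    rw [← finsum_eq_sum_of_fintype]
    exact χ.sum_eq_one (mem_univ x)
  have hstokes := sum_integral_coordDensity_eq_zero (fun k : t => hU k)
    (fun k => (χ k).contMDiff) hχ hχ1 i₀ hw hw'
  set G : t → EuclideanSpace ℝ (Fin m) → ℂ := fun k y => (χ k ((φ (k : L)).symm y) : ℂ) *
    coordDensity o w k ((φ (k : L)).symm y) with hG
  have hGc : ∀ k : t, ContinuousOn (G k) (chartImage (m := m) (k : L) (U k)) := fun k =>
    (integrableOn_mul_coordDensity hw (hU k) (χ k).contMDiff.continuous (hχ k)).1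
  have hGi : ∀ k : t, IntegrableOn (G k) (chartImage (m := m) (k : L) (U k)) := fun k =>
    (integrableOn_mul_coordDensity hw (hU k) (χ k).contMDiff.continuous (hχ k)).2
  have hre : ∀ (a x : L), (z * coordDensity o w a x).re = frameSign (o x) (coordFrame a x) *
      (z * Matrix.det (Matrix.of fun i j => cdiff m (w j) x (coordFrame a x i))).re := by
    intro a x
    rw [coordDensity, mul_left_comm, Complex.re_ofReal_mul]
  have hGre : ∀ (k : t) y, (z * G k y).re = χ k ((φ (k : L)).symm y) *
      (z * coordDensity o w k ((φ (k : L)).symm y)).re := by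
    intro k y
    rw [hG, mul_left_comm, Complex.re_ofReal_mul]
  have hGnn : ∀ (k : t) y, 0 ≤ (z * G k y).re := by
    intro k y
    rw [hGre, hre]
    exact mul_nonneg (χ.nonneg k _) (hpos _ _)
  have hGri : ∀ k : t, IntegrableOn (fun y => (z * G k y).re)
      (chartImage (m := m) (k : L) (U k)) := fun k => ((hGi k).const_mul z).re
  have hzero : ∑ k : t, ∫ y in chartImage (m := m) (k : L) (U k), (z * G k y).re = 0 := by
    have h1 : ∀ k : t, ∫ y in chartImage (m := m) (k : L) (U k), (z * G k y).re =
        (z * ∫ y in chartImage (m := m) (k : L) (U k), G k y).re := by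
      intro k
      rw [← integral_const_mul]
      exact integral_re ((hGi k).const_mul z)
    simp_rw [h1]
    rw [← Complex.re_sum, ← Finset.mul_sum, hstokes, mul_zero, Complex.zero_re]
  have hzero' := (Finset.sum_eq_zero_iff_of_nonneg fun k _ =>
    integral_nonneg (hGnn k)).1 hzero
  have hGz : ∀ k : t, EqOn (fun y => (z * G k y).re) (fun _ => 0)
      (chartImage (m := m) (k : L) (U k)) := by
    intro k
    -- A nonnegative function with zero integral vanishes almost everywhere, and continuity on an
    -- open set makes this hold everywhere.
    refine Measure.eqOn_open_of_ae_eq ?_ (isOpen_chartImage _ (hU k).isOpen)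
      (Complex.continuous_re.comp_continuousOn (continuousOn_const.mul (hGc k))) continuousOn_const
      (μ := volume)
    exact (integral_eq_zero_iff_of_nonneg (hGnn k) (hGri k)).1 (hzero' k (Finset.mem_univ k))
  obtain ⟨k, hk⟩ : ∃ k : t, χ k x ≠ 0 := by
    by_contra! h
    have := hχ1 x
    rw [Finset.sum_eq_zero fun k _ => h k] at this
    exact zero_ne_one this
  have hxU : x ∈ U k := hχ k (subset_tsupport _ hk)
  have hxs : x ∈ (φ (k : L)).source := (hU k).subset hxU
  -- A coordinate frame is a basis, so the conclusion carries information: on a dependent family the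
  -- vanishing would be trivial.
  refine ⟨coordFrame (k : L) x, ?_, ?_⟩
  · rw [← coe_coordBasis (k : L) x hxs]
    exact (coordBasis (k : L) x hxs).linearIndependent
  · have h1 : φ (k : L) x ∈ chartImage (m := m) (k : L) (U k) := by
      refine ⟨(φ (k : L)).map_source hxs, ?_⟩
      rw [mem_preimage, (φ (k : L)).left_inv hxs]
      exact hxU
    have h2 := hGz k h1
    simp only at h2
    rw [hGre, (φ (k : L)).left_inv hxs, hre] at h2
    have hs : frameSign (o x) (coordFrame (k : L) x) ≠ 0 := by
      unfold frameSign
      split_ifs <;> norm_num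
    exact (mul_eq_zero.1 ((mul_eq_zero.1 h2).resolve_left hk)).resolve_left hs

end Stokes

/-! ### Holomorphic functions of several variables -/

section Holomorphic

variable {E : Type*} [NormedAddCommGroup E] [NormedSpace ℂ E] [FiniteDimensional ℂ E]

/-- A holomorphic function of several variables is continuously differentiable. -/
theorem contDiffOn_one_of_differentiableOn_complex {h : E → ℂ} {U : Set E}
    (hh : DifferentiableOn ℂ h U) (hU : IsOpen U) : ContDiffOn ℂ 1 h U := by
  have : ProperSpace E := FiniteDimensional.proper ℂ E
  rw [show (1 : WithTop ℕ∞) = 0 + 1 by norm_num, contDiffOn_succ_iff_fderiv_of_isOpen hU]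
  refine ⟨hh, by simp, ?_⟩
  rw [contDiffOn_zero, continuousOn_clm_apply]
  intro v z₀ hz₀
  obtain ⟨r, hr, hrU⟩ := Metric.isOpen_iff.1 hU z₀ hz₀
  -- With this radius all discs z + ζv, for z near z₀, stay in a compact ball inside U; the added 1
  -- covers v = 0.
  set ρ : ℝ := r / 4 / (‖v‖ + 1) with hρdef
  have hv : 0 < ‖v‖ + 1 := by positivity
  have hρ : 0 < ρ := by positivity
  have hρv : ∀ ζ ∈ Metric.ball (0 : ℂ) ρ, ‖ζ • v‖ ≤ r / 4 := by
    intro ζ hζ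
    rw [norm_smul]
    calc ‖ζ‖ * ‖v‖ ≤ ρ * (‖v‖ + 1) := by
          have := mem_ball_zero_iff.1 hζ
          gcongr
          linarith
      _ = r / 4 := by rw [hρdef]; field_simp
  have hmem : ∀ z ∈ Metric.ball z₀ (r / 4), ∀ ζ ∈ Metric.ball (0 : ℂ) ρ,
      z + ζ • v ∈ Metric.closedBall z₀ (r / 2) := by
    intro z hz ζ hζ
    rw [mem_closedBall_iff_norm]
    have h1 := mem_ball_iff_norm.1 hz
    calc ‖z + ζ • v - z₀‖ = ‖(z - z₀) + ζ • v‖ := by congr 1; abel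
      _ ≤ ‖z - z₀‖ + ‖ζ • v‖ := norm_add_le _ _
      _ ≤ r / 2 := by linarith [hρv ζ hζ]
  have hKU : Metric.closedBall z₀ (r / 2) ⊆ U :=
    (Metric.closedBall_subset_ball (by linarith)).trans hrU
  have huc : UniformContinuousOn h (Metric.closedBall z₀ (r / 2)) :=
    (isCompact_closedBall z₀ (r / 2)).uniformContinuousOn_of_continuous (hh.continuousOn.mono hKU)
  have hnhds : Metric.ball z₀ (r / 4) ∈ 𝓝 z₀ := Metric.ball_mem_nhds _ (by positivity)
  have hunif : TendstoUniformlyOn (fun z (ζ : ℂ) => h (z + ζ • v)) (fun ζ => h (z₀ + ζ • v)) (𝓝 z₀)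
      (Metric.ball 0 ρ) := by
    rw [Metric.tendstoUniformlyOn_iff]
    intro ε hε
    obtain ⟨δ, hδ, hδε⟩ := Metric.uniformContinuousOn_iff.1 huc ε hε
    filter_upwards [hnhds, Metric.ball_mem_nhds z₀ hδ] with z hz hzδ ζ hζ
    refine hδε _ (hmem z₀ (mem_of_mem_nhds hnhds) ζ hζ) _ (hmem z hz ζ hζ) ?_
    rw [dist_add_right, dist_comm]
    exact hzδ
  have hder : ∀ z ∈ Metric.ball z₀ (r / 4), ∀ ζ ∈ Metric.ball (0 : ℂ) ρ,
      HasDerivAt (fun ζ : ℂ => h (z + ζ • v)) (fderiv ℂ h (z + ζ • v) v) ζ := by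
    intro z hz ζ hζ
    have h1 := (hh.differentiableAt (hU.mem_nhds (hKU (hmem z hz ζ hζ)))).hasFDerivAt
    have h2 : HasDerivAt (fun ζ : ℂ => z + ζ • v) v ζ := by
      simpa using ((hasDerivAt_id ζ).smul_const v).const_add z
    exact h1.comp_hasDerivAt ζ h2
  -- Weierstrass: the one-variable slices converge uniformly on the disc as z → z₀, hence so do
  -- their derivatives at 0, which are the derivatives of h along v.
  have hlim := (hunif.tendstoLocallyUniformlyOn.deriv (by
      filter_upwards [hnhds] with z hz ζ hζ
      exact (hder z hz ζ hζ).differentiableAt.differentiableWithinAt) Metric.isOpen_ball).tendsto_at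
    (Metric.mem_ball_self hρ)
  have h0 : ∀ z ∈ Metric.ball z₀ (r / 4), deriv (fun ζ : ℂ => h (z + ζ • v)) 0 = fderiv ℂ h z v := by
    intro z hz
    simpa using (hder z hz 0 (Metric.mem_ball_self hρ)).deriv
  rw [h0 z₀ (mem_of_mem_nhds hnhds)] at hlim
  refine ContinuousAt.continuousWithinAt (hlim.congr' ?_)
  filter_upwards [hnhds] with z hz
  exact h0 z hz

/-- A holomorphic function near a point of a complex vector space has a holomorphic primitive in a
given direction. -/
theorem exists_holomorphic_primitive (l : E →L[ℂ] ℂ) {e : E} (hle : l e = 1) {h : E → ℂ} {y₀ : E}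
    {r : ℝ} (hr : 0 < r) (hh : DifferentiableOn ℂ h (Metric.ball y₀ r)) :
    ∃ s, 0 < s ∧ s ≤ r ∧ ∃ H : E → ℂ, ContDiffOn ℂ 1 H (Metric.ball y₀ s) ∧
      ∀ y ∈ Metric.ball y₀ s, fderiv ℂ H y e = h y := by
  have : ProperSpace E := FiniteDimensional.proper ℂ E
  -- `A t` fixes ker l and scales e by t, so `p z` runs along e from the hyperplane l = l(y₀) to z.
  -- The primitive H(z) = l(z - y₀) ∫₀¹ h(p z t) dt is the integral of h along this segment. The
  -- radius s = r / (2C) keeps the path in a compact ball.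
  set A : ℝ → E →L[ℂ] E := fun t =>
    ContinuousLinearMap.id ℂ E + ((t : ℂ) - 1) • l.smulRight e with hA
  set C : ℝ := 1 + ‖l.smulRight e‖ with hC
  have hC0 : 0 < C := by positivity
  have hAC : ∀ t ∈ Icc (0 : ℝ) 1, ‖A t‖ ≤ C := by
    intro t ht
    refine (norm_add_le _ _).trans (add_le_add ContinuousLinearMap.norm_id_le ?_)
    rw [norm_smul]
    refine mul_le_of_le_one_left (norm_nonneg _) ?_
    rw [← Complex.ofReal_one, ← Complex.ofReal_sub, Complex.norm_real, Real.norm_eq_abs, abs_le]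
    constructor <;> linarith [ht.1, ht.2]
  have hAcont : Continuous A :=
    continuous_const.add ((Complex.continuous_ofReal.sub continuous_const).smul continuous_const)
  set s : ℝ := r / (2 * C) with hs
  have hs0 : 0 < s := by positivity
  have hC1 : 1 ≤ C := by rw [hC]; linarith [norm_nonneg (l.smulRight e)]
  have hsr : s ≤ r := by
    rw [hs, div_le_iff₀ (by positivity)]
    nlinarith
  set p : E → ℝ → E := fun z t => y₀ + A t (z - y₀) with hp
  have hpmem : ∀ z ∈ Metric.ball y₀ s, ∀ t ∈ Icc (0 : ℝ) 1,
      p z t ∈ Metric.closedBall y₀ (r / 2) := by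
    intro z hz t ht
    rw [mem_closedBall_iff_norm, hp, add_sub_cancel_left]
    calc ‖A t (z - y₀)‖ ≤ ‖A t‖ * ‖z - y₀‖ := (A t).le_opNorm _
      _ ≤ C * s := mul_le_mul (hAC t ht) (mem_ball_iff_norm.1 hz).le (norm_nonneg _) hC0.le
      _ = r / 2 := by rw [hs]; field_simp
  have hKU : Metric.closedBall y₀ (r / 2) ⊆ Metric.ball y₀ r :=
    Metric.closedBall_subset_ball (by linarith)
  have hpU : ∀ z ∈ Metric.ball y₀ s, ∀ t ∈ Icc (0 : ℝ) 1, p z t ∈ Metric.ball y₀ r :=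
    fun z hz t ht => hKU (hpmem z hz t ht)
  have hh1 := contDiffOn_one_of_differentiableOn_complex hh Metric.isOpen_ball
  have hfc : ContinuousOn (fderiv ℂ h) (Metric.ball y₀ r) :=
    hh1.continuousOn_fderiv_of_isOpen Metric.isOpen_ball le_rfl
  obtain ⟨B, hB⟩ := (isCompact_closedBall y₀ (r / 2)).exists_bound_of_continuousOn (hfc.mono hKU)
  have hder : ∀ y ∈ Metric.ball y₀ r, HasFDerivAt h (fderiv ℂ h y) y := fun y hy =>
    (hh.differentiableAt (Metric.isOpen_ball.mem_nhds hy)).hasFDerivAt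
  have hpcont : ∀ z, Continuous (p z) := fun z =>
    continuous_const.add (hAcont.clm_apply continuous_const)
  have hFcont : ∀ z ∈ Metric.ball y₀ s, ContinuousOn (fun t => h (p z t)) (Icc 0 1) := fun z hz =>
    hh.continuousOn.comp (hpcont z).continuousOn (hpU z hz)
  set F' : E → ℝ → E →L[ℂ] ℂ := fun z t => (fderiv ℂ h (p z t)).comp (A t) with hF'
  have hF'cont : ∀ z ∈ Metric.ball y₀ s, ContinuousOn (F' z) (Icc 0 1) := fun z hz =>
    (hfc.comp (hpcont z).continuousOn (hpU z hz)).clm_comp hAcont.continuousOn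
  have hIcc : uIcc (0 : ℝ) 1 = Icc 0 1 := uIcc_of_le zero_le_one
  have hIoc : uIoc (0 : ℝ) 1 ⊆ Icc 0 1 := by
    rw [uIoc_of_le zero_le_one]
    exact Ioc_subset_Icc_self
  set G : E → ℂ := fun z => ∫ t in (0 : ℝ)..1, h (p z t) with hG
  have hGder : ∀ z ∈ Metric.ball y₀ s, HasFDerivAt G (∫ t in (0 : ℝ)..1, F' z t) z := by
    intro z hz
    refine intervalIntegral.hasFDerivAt_integral_of_dominated_of_fderiv_le
      (F := fun z t => h (p z t)) (F' := F') (bound := fun _ => B * C)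
      (Metric.isOpen_ball.mem_nhds hz) ?_ ?_ ?_ ?_ ?_ ?_
    · filter_upwards [Metric.isOpen_ball.mem_nhds hz] with y hy
      exact ((hFcont y hy).mono hIoc).aestronglyMeasurable measurableSet_uIoc
    · exact ContinuousOn.intervalIntegrable (by rw [hIcc]; exact hFcont z hz)
    · exact ((hF'cont z hz).mono hIoc).aestronglyMeasurable measurableSet_uIoc
    · refine Eventually.of_forall fun t ht y hy => ?_
      refine (ContinuousLinearMap.opNorm_comp_le _ _).trans ?_
      have h1 := hB _ (hpmem y hy t (hIoc ht))
      exact mul_le_mul h1 (hAC t (hIoc ht)) (norm_nonneg _) ((norm_nonneg _).trans h1)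
    · exact intervalIntegrable_const
    · refine Eventually.of_forall fun t ht y hy => ?_
      have h1 := hder _ (hpU y hy t (hIoc ht))
      have h2 : HasFDerivAt (fun y => p y t) (A t) y := by
        exact ((A t).hasFDerivAt.comp y ((hasFDerivAt_id y).sub_const y₀)).const_add y₀
      exact h1.comp y h2
  have hHder : ∀ z ∈ Metric.ball y₀ s, HasFDerivAt (fun z => l (z - y₀) * G z)
      (l (z - y₀) • (∫ t in (0 : ℝ)..1, F' z t) + G z • l) z := by
    intro z hz
    have h1 : HasFDerivAt (fun z => l (z - y₀)) l z := by
      exact l.hasFDerivAt.comp z ((hasFDerivAt_id z).sub_const y₀)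
    exact h1.mul (hGder z hz)
  refine ⟨s, hs0, hsr, fun z => l (z - y₀) * G z, ?_, ?_⟩
  · refine contDiffOn_one_of_differentiableOn_complex (fun z hz => ?_) Metric.isOpen_ball
    exact (hHder z hz).differentiableAt.differentiableWithinAt
  · intro z hz
    have hF'i : IntervalIntegrable (F' z) MeasureTheory.volume 0 1 :=
      ContinuousOn.intervalIntegrable (by rw [hIcc]; exact hF'cont z hz)
    have hFi : IntervalIntegrable (fun t => h (p z t)) MeasureTheory.volume 0 1 :=
      ContinuousOn.intervalIntegrable (by rw [hIcc]; exact hFcont z hz)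
    have hF'e : ∀ t, F' z t e = t * fderiv ℂ h (p z t) e := by
      intro t
      have : A t e = (t : ℂ) • e := by
        simp [hA, hle, sub_smul]
      rw [hF', ContinuousLinearMap.comp_apply, this, map_smul, smul_eq_mul]
    have hF'ei : IntervalIntegrable (fun t => F' z t e) MeasureTheory.volume 0 1 :=
      ContinuousOn.intervalIntegrable (by
        rw [hIcc]; exact (hF'cont z hz).clm_apply continuousOn_const)
    -- The derivative of H along e is the integral of the t-derivative of t · h(p z t), hence equal
    -- to h(p z 1) = h z.
    have hprim : ∀ t ∈ uIcc (0 : ℝ) 1, HasDerivAt (fun t : ℝ => (t : ℂ) * h (p z t))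
        (h (p z t) + l (z - y₀) * F' z t e) t := by
      intro t ht
      rw [hIcc] at ht
      have h1 : HasDerivAt (p z) (l (z - y₀) • e) t := by
        have h2 : HasDerivAt (fun t : ℝ => (t : ℂ)) 1 t := Complex.ofRealCLM.hasDerivAt
        have h3 := ((h2.sub_const 1).smul_const (l (z - y₀) • e)).const_add (z - y₀)
        have h4 := h3.const_add y₀
        rw [one_smul] at h4
        refine h4.congr_of_eventuallyEq (Eventually.of_forall fun t => ?_)
        simp [hp, hA]
      have h5 := ((hder _ (hpU z hz t ht)).restrictScalars ℝ).comp_hasDerivAt t h1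
      have h6 := (Complex.ofRealCLM.hasDerivAt (x := t)).mul h5
      refine h6.congr_deriv ?_
      rw [hF'e]
      simp
      ring
    have hint := intervalIntegral.integral_eq_sub_of_hasDerivAt hprim
      (hFi.add (hF'ei.const_mul (l (z - y₀))))
    rw [intervalIntegral.integral_add hFi (hF'ei.const_mul _),
      intervalIntegral.integral_const_mul] at hint
    rw [(hHder z hz).fderiv, add_apply, smul_apply, smul_apply, hle,
      ContinuousLinearMap.intervalIntegral_apply hF'i, smul_eq_mul, smul_eq_mul, mul_one, add_comm]
    rw [hG, hint]
    simp [hp, hA]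

end Holomorphic

/-! ### Local functions with Ω = dw₁ ∧ ⋯ ∧ dw_m -/

section UnimodularCoordinates

variable {m : ℕ} {M : Type*} [TopologicalSpace M] [ChartedSpace (Cm m) M]
  [IsManifold 𝓘(ℂ, Cm m) ω M]

/-- Functions `w₁, …, w_m` on an open set `V` with `Ω = dw₁ ∧ ⋯ ∧ dw_m`. -/
structure IsUnimodular (X : HermitianData m M) (V : Set M) (i₀ : Fin m) (w : Fin m → M → ℂ) :
    Prop where
  isOpen : IsOpen V
  contMDiffOn_one : ∀ j, ContMDiffOn 𝓘(ℝ, Cm m) 𝓘(ℝ, ℂ) 1 (w j) V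
  contMDiffOn_two : ∀ j, j ≠ i₀ → ContMDiffOn 𝓘(ℝ, Cm m) 𝓘(ℝ, ℂ) 2 (w j) V
  det_eq : ∀ x ∈ V, ∀ v : Fin m → RTangent m x, X.OmReal x v = Matrix.det (Matrix.of fun i j =>
    (show RTangent m x →L[ℝ] ℂ from mfderiv 𝓘(ℝ, Cm m) 𝓘(ℝ, ℂ) (w j) x) (v i))

theorem flatData_isUnimodular (i₀ : Fin m) :
    IsUnimodular (flatData m) univ i₀ fun j z => z j where
  isOpen := isOpen_univ
  contMDiffOn_one j := by
    refine ContDiff.contMDiff ?_ |>.contMDiffOn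
    exact ((EuclideanSpace.proj (𝕜 := ℂ) (ι := Fin m) j).restrictScalars ℝ).contDiff
  contMDiffOn_two j _ := by
    refine ContDiff.contMDiff ?_ |>.contMDiffOn
    exact ((EuclideanSpace.proj (𝕜 := ℂ) (ι := Fin m) j).restrictScalars ℝ).contDiff
  det_eq x _ v := by
    have h : ∀ j, mfderiv 𝓘(ℝ, Cm m) 𝓘(ℝ, ℂ) (fun z : Cm m => z j) x =
        (EuclideanSpace.proj (𝕜 := ℂ) (ι := Fin m) j).restrictScalars ℝ := fun j => by
      rw [mfderiv_eq_fderiv]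
      exact ((EuclideanSpace.proj (𝕜 := ℂ) (ι := Fin m) j).restrictScalars ℝ).fderiv
    simp only [h]
    rfl

theorem HasMFDerivAt.restrict_scalars_complex {E F : Type*} [NormedAddCommGroup E] [NormedSpace ℂ E]
    [NormedAddCommGroup F] [NormedSpace ℂ F] {N N' : Type*} [TopologicalSpace N] [ChartedSpace E N]
    [TopologicalSpace N'] [ChartedSpace F N'] {f : N → N'} {x : N} {f' : E →L[ℂ] F}
    (h : HasMFDerivAt 𝓘(ℂ, E) 𝓘(ℂ, F) f x f') :
    HasMFDerivAt 𝓘(ℝ, E) 𝓘(ℝ, F) f x (f'.restrictScalars ℝ) :=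
  ⟨h.1, HasFDerivWithinAt.restrictScalars ℝ h.2⟩

/-- Expanding l in coordinates, every term except the one for i₀ repeats another column and
contributes nothing. -/
theorem det_updateCol_linear_combination {ι : Type*} [Fintype ι] [DecidableEq ι]
    (l : EuclideanSpace ℂ ι →ₗ[ℂ] ℂ) (i₀ : ι) (u : ι → EuclideanSpace ℂ ι) :
    Matrix.det (Matrix.of fun i j => if j = i₀ then l (u i) else u i j) =
      l (EuclideanSpace.single i₀ 1) * Matrix.det (Matrix.of fun i j => u i j) := by
  have h := Matrix.det_updateCol_sum (Matrix.of fun i j => u i j) i₀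
    (fun k => l (EuclideanSpace.single k 1))
  rw [smul_eq_mul] at h
  rw [← h]
  congr 1
  ext i j
  by_cases hj : j = i₀
  · subst hj
    rw [Matrix.of_apply, if_pos rfl, Matrix.updateCol_self]
    conv_lhs => rw [← (EuclideanSpace.basisFun ι ℂ).sum_repr (u i), map_sum]
    simp [mul_comm]
  · simp [hj]

theorem HermitianData.IsCalabiYau.exists_isUnimodular {X : HermitianData m M} (hX : X.IsCalabiYau)
    (p : M) (i₀ : Fin m) : ∃ V w, p ∈ V ∧ IsUnimodular X V i₀ w := by
  set φ := chartAt (Cm m) p with hφ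
  obtain ⟨r, hr, hrt⟩ := Metric.isOpen_iff.1 φ.open_target (φ p)
    (φ.map_source (mem_chart_source _ p))
  set h : Cm m → ℂ := fun y => X.OmInChart p y fun i => EuclideanSpace.single i 1 with hh
  have hd : DifferentiableOn ℂ h (Metric.ball (φ p) r) := by
    intro y hy
    have h1 := (hX.holomorphic p).mono hrt y hy
    exact h1.continuousAlternatingMap_apply_const _
  obtain ⟨s, hs, hsr, H, hH, hHder⟩ := exists_holomorphic_primitive
    (EuclideanSpace.proj (𝕜 := ℂ) (ι := Fin m) i₀) (e := EuclideanSpace.single i₀ 1)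
    (by simp) hr hd
  -- Only the coordinate y_{i₀} is replaced, by the primitive H of the coefficient h of Ω; the
  -- Jacobian determinant is then ∂H/∂y_{i₀} = h.
  set g : Fin m → Cm m → ℂ := fun j y => if j = i₀ then H y else y j with hg
  have hV : IsOpen (φ.source ∩ φ ⁻¹' Metric.ball (φ p) s) :=
    φ.isOpen_inter_preimage Metric.isOpen_ball
  have hgproj : ∀ (n : WithTop ℕ∞) j, j ≠ i₀ → ContDiff ℝ n (g j) := by
    intro n j hj
    simp only [hg, if_neg hj]
    exact ((EuclideanSpace.proj (𝕜 := ℂ) (ι := Fin m) j).restrictScalars ℝ).contDiff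
  have hg1 : ∀ j, ContDiffOn ℝ 1 (g j) (Metric.ball (φ p) s) := by
    intro j
    by_cases hj : j = i₀
    · simp only [hg, if_pos hj]
      exact hH.restrict_scalars ℝ
    · exact (hgproj 1 j hj).contDiffOn
  have hg2 : ∀ j, j ≠ i₀ → ContDiffOn ℝ 2 (g j) (Metric.ball (φ p) s) := fun j hj =>
    (hgproj 2 j hj).contDiffOn
  have hcomp : ∀ (n : WithTop ℕ∞) j, ContDiffOn ℝ n (g j) (Metric.ball (φ p) s) →
      ContMDiffOn 𝓘(ℝ, Cm m) 𝓘(ℝ, ℂ) n (g j ∘ φ) (φ.source ∩ φ ⁻¹' Metric.ball (φ p) s) := by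
    intro n j hn
    have hM : IsManifold 𝓘(ℝ, Cm m) n M := IsManifold.of_le (n := ω) le_top
    exact hn.contMDiffOn.comp ((contMDiffOn_chart (I := 𝓘(ℝ, Cm m)) (n := n)).mono
      inter_subset_left) inter_subset_right
  refine ⟨φ.source ∩ φ ⁻¹' Metric.ball (φ p) s, fun j => g j ∘ φ,
    ⟨mem_chart_source _ p, Metric.mem_ball_self hs⟩, hV, fun j => hcomp 1 j (hg1 j),
    fun j hj => hcomp 2 j (hg2 j hj), ?_⟩
  intro x hx v
  obtain ⟨y, hy, rfl⟩ : ∃ y ∈ φ.target, φ.symm y = x :=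
    ⟨φ x, φ.map_source hx.1, φ.left_inv hx.1⟩
  have hxs := hx.1
  have hys : y ∈ Metric.ball (φ p) s := by
    have := hx.2
    rwa [mem_preimage, φ.right_inv hy] at this
  have hφm : MDifferentiableAt 𝓘(ℂ, Cm m) 𝓘(ℂ, Cm m) φ (φ.symm y) :=
    mdifferentiableAt_atlas (I := 𝓘(ℂ, Cm m)) (chart_mem_atlas _ p) hxs
  set D : Cm m →L[ℂ] Cm m := mfderiv 𝓘(ℂ, Cm m) 𝓘(ℂ, Cm m) φ (φ.symm y) with hD
  have hDR : HasMFDerivAt 𝓘(ℝ, Cm m) 𝓘(ℝ, Cm m) φ (φ.symm y) (D.restrictScalars ℝ) :=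
    HasMFDerivAt.restrict_scalars_complex hφm.hasMFDerivAt
  set v' : Fin m → Cm m := v with hv'
  have hder : ∀ j, HasMFDerivAt 𝓘(ℝ, Cm m) 𝓘(ℝ, ℂ) (g j ∘ φ) (φ.symm y)
      ((fderiv ℝ (g j) y).comp (D.restrictScalars ℝ)) := by
    intro j
    have h1 : HasFDerivAt (g j) (fderiv ℝ (g j) y) (φ (φ.symm y)) := by
      rw [φ.right_inv hy]
      exact (((hg1 j).differentiableOn one_ne_zero).differentiableAt
        (Metric.isOpen_ball.mem_nhds hys)).hasFDerivAt
    exact HasMFDerivAt.comp _ h1.hasMFDerivAt hDR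
  have hinv : ∀ u : Cm m, (mfderiv 𝓘(ℂ, Cm m) 𝓘(ℂ, Cm m) φ.symm y : Cm m →L[ℂ] Cm m) (D u) = u := by
    intro u
    have h1 := OpenPartialHomeomorph.MDifferentiable.symm_comp_deriv
      (mdifferentiable_of_mem_atlas (I := 𝓘(ℂ, Cm m)) (chart_mem_atlas (Cm m) p)) hxs
    have key : ∀ y', y' = y → ∀ u : Cm m,
        (mfderiv 𝓘(ℂ, Cm m) 𝓘(ℂ, Cm m) φ.symm y : Cm m →L[ℂ] Cm m) u =
        (mfderiv 𝓘(ℂ, Cm m) 𝓘(ℂ, Cm m) φ.symm y' : Cm m →L[ℂ] Cm m) u := by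
      rintro _ rfl _
      rfl
    exact (key _ (φ.right_inv hy) _).trans (DFunLike.congr_fun h1 u)
  have hOm : X.OmReal (φ.symm y) v = X.OmInChart p y fun i => D (v' i) := by
    refine Eq.trans ?_ (congrArg (X.Om (φ.symm y)) (funext fun i => hinv (v' i))).symm
    rfl
  have hOm' : X.OmInChart p y (fun i => D (v' i)) =
      h y * Matrix.det (Matrix.of fun i j => D (v' i) j) := by
    have h1 := AlternatingMap.eq_smul_basis_det (EuclideanSpace.basisFun (Fin m) ℂ).toBasis
      (X.OmInChart p y).toAlternatingMap
    have h2 := DFunLike.congr_fun h1 fun i => D (v' i)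
    refine h2.trans ?_
    rw [AlternatingMap.smul_apply, Module.Basis.det_apply, ← Matrix.det_transpose, smul_eq_mul]
    congr 1
    · refine congrArg (X.OmInChart p y) (funext fun i => ?_)
      simp
  have hgder : ∀ i j, fderiv ℝ (g j) y (D (v' i)) =
      if j = i₀ then (fderiv ℂ H y).toLinearMap (D (v' i)) else D (v' i) j := by
    intro i j
    by_cases hj : j = i₀
    · rw [if_pos hj]
      have h1 : g j = H := by simp [hg, hj]
      have h2 : DifferentiableAt ℂ H y := (hH.differentiableOn one_ne_zero).differentiableAt
        (Metric.isOpen_ball.mem_nhds hys)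
      rw [h1, h2.fderiv_restrictScalars ℝ]
      rfl
    · rw [if_neg hj]
      have h1 : g j = (EuclideanSpace.proj (𝕜 := ℂ) (ι := Fin m) j).restrictScalars ℝ := by
        ext z
        simp [hg, hj]
      rw [h1, ContinuousLinearMap.fderiv]
      rfl
  rw [hOm, hOm', ← hHder y hys]
  have h3 := det_updateCol_linear_combination (fderiv ℂ H y).toLinearMap i₀ fun i => D (v' i)
  refine h3.symm.trans ?_
  simp only [← hgder]
  congr 2
  ext i j
  exact (DFunLike.congr_fun (hder j).mfderiv (v' i)).symm

end UnimodularCoordinates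

/-! ### Phases of compact graded Lagrangians -/

section Graded

variable {m : ℕ} {M : Type*} [TopologicalSpace M] [ChartedSpace (Cm m) M]
  [IsManifold 𝓘(ℂ, Cm m) ω M] {X : HermitianData m M}
  {L : Type*} [TopologicalSpace L] [ChartedSpace (EuclideanSpace ℝ (Fin m)) L]
  [IsManifold (𝓡 m) ∞ L]

omit [IsManifold 𝓘(ℂ, Cm m) ω M] [IsManifold (𝓡 m) ∞ L] in
theorem contMDiff_indicator_comp {n : WithTop ℕ∞} (hn : n ≤ ∞) {f : L → M}
    (hf : ContMDiff (𝓡 m) 𝓘(ℝ, Cm m) ∞ f) {A : Set L} (hA : IsClopen A) {V : Set M} (hV : IsOpen V)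
    (hAV : MapsTo f A V) {w : M → ℂ} (hw : ContMDiffOn 𝓘(ℝ, Cm m) 𝓘(ℝ, ℂ) n w V) :
    ContMDiff (𝓡 m) 𝓘(ℝ, ℂ) n (A.indicator (w ∘ f)) := by
  intro x
  by_cases hx : x ∈ A
  · have h1 : ContMDiffAt (𝓡 m) 𝓘(ℝ, ℂ) n (w ∘ f) x :=
      (hw.contMDiffAt (hV.mem_nhds (hAV hx))).comp x ((hf x).of_le hn)
    refine h1.congr_of_eventuallyEq ?_
    filter_upwards [hA.isOpen.mem_nhds hx] with y hy
    exact indicator_of_mem hy _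
  · refine (contMDiffAt_const (c := (0 : ℂ))).congr_of_eventuallyEq ?_
    filter_upwards [hA.compl.isOpen.mem_nhds hx] with y hy
    exact indicator_of_notMem hy _

omit [IsManifold 𝓘(ℂ, Cm m) ω M] [IsManifold (𝓡 m) ∞ L] in
theorem cdiff_indicator_comp_apply {f : L → M}
    (hf : ContMDiff (𝓡 m) 𝓘(ℝ, Cm m) ∞ f) {A : Set L} (hA : IsClopen A) {V : Set M} (hV : IsOpen V)
    (hAV : MapsTo f A V) {w : M → ℂ} (hw : ContMDiffOn 𝓘(ℝ, Cm m) 𝓘(ℝ, ℂ) 1 w V) {x : L}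
    (hx : x ∈ A) (v : TangentSpace (𝓡 m) x) :
    cdiff m (A.indicator (w ∘ f)) x v =
      (show RTangent m (f x) →L[ℝ] ℂ from mfderiv 𝓘(ℝ, Cm m) 𝓘(ℝ, ℂ) w (f x)) (dmap m f x v) := by
  have h1 : A.indicator (w ∘ f) =ᶠ[𝓝 x] w ∘ f := by
    filter_upwards [hA.isOpen.mem_nhds hx] with y hy
    exact indicator_of_mem hy _
  rw [cdiff_congr h1]
  have h2 := mfderiv_comp x ((hw.contMDiffAt (hV.mem_nhds (hAV hx))).mdifferentiableAt one_ne_zero)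
    ((hf x).mdifferentiableAt (by simp))
  exact DFunLike.congr_fun h2 v

namespace OrientedLagrangian

variable (F : OrientedLagrangian L X)

/-- The unsigned volume density of the induced metric. -/
def volDensity (x : L) (v : Fin m → TangentSpace (𝓡 m) x) : ℝ :=
  Real.sqrt (Matrix.det (Matrix.of fun i j : Fin m =>
    X.g.inner (F.f x) (dmap m F.f x (v i)) (dmap m F.f x (v j))))

theorem volForm_eq (x : L) (v : Fin m → TangentSpace (𝓡 m) x) :
    F.volForm x v = frameSign (F.o x) v * F.volDensity x v := by
  unfold volForm volDensity frameSign
  dsimp only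
  split_ifs <;> simp

/-- The differential is injective, so the Gram matrix of the image vectors is positive definite. -/
theorem volDensity_pos {x : L} {v : Fin m → TangentSpace (𝓡 m) x} (hv : LinearIndependent ℝ v) :
    0 < F.volDensity x v := by
  refine Real.sqrt_pos.2 (Matrix.PosDef.det_pos ?_)
  refine Matrix.PosDef.of_dotProduct_mulVec_pos ?_ ?_
  · ext i j
    simp only [Matrix.conjTranspose_apply, Matrix.of_apply, star_trivial]
    exact X.g.symm _ _ _
  · intro c hc
    have h1 : dmap m F.f x (∑ i, c i • v i) ≠ 0 := by
      intro h0
      have h2 := F.immersion x (h0.trans (map_zero _).symm)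
      exact hc (funext fun i => Fintype.linearIndependent_iff.1 hv c h2 i)
    have h3 := X.g.pos (F.f x) _ h1
    have h4 : X.g.inner (F.f x) (dmap m F.f x (∑ i, c i • v i)) (dmap m F.f x (∑ i, c i • v i)) =
        ∑ i, c i * ∑ j, X.g.inner (F.f x) (dmap m F.f x (v i)) (dmap m F.f x (v j)) * c j := by
      simp only [map_sum, map_smul, sum_apply, smul_apply,
        smul_eq_mul, Finset.mul_sum]
      rw [Finset.sum_comm]
      refine Finset.sum_congr rfl fun i _ => Finset.sum_congr rfl fun j _ => ?_
      ring
    rw [h4] at h3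
    exact h3

end OrientedLagrangian

namespace GradedLagrangian

variable (F : GradedLagrangian L X)

/-- This is Re(e^{iα}Ω) = cos(θ + α) dV on L, the identity that links the phase to Stokes' theorem.
-/
theorem re_exp_mul_omRestrict (α : ℝ) (x : L) (v : Fin m → TangentSpace (𝓡 m) x) :
    (Complex.exp (Complex.I * α) * F.omRestrict x v).re =
      frameSign (F.o x) v * (F.volDensity x v * Real.cos (F.θ x + α)) := by
  rw [F.phase, F.volForm_eq, ← mul_assoc, ← Complex.exp_add, mul_comm, Complex.re_ofReal_mul,
    mul_assoc]
  congr 2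
  rw [← mul_add, mul_comm, ← Complex.ofReal_add, Complex.exp_ofReal_mul_I_re, add_comm]

/-- If the phase of a compact part of a graded Lagrangian, lying in a domain on which
`Ω = dw₁ ∧ ⋯ ∧ dw_m`, is within `π / 2` of a constant, then it is equal to that constant
plus or minus `π / 2`. -/
theorem cos_eq_zero [CompactSpace L] [T2Space L] {V : Set M} {i₀ : Fin m} {w : Fin m → M → ℂ}
    (hw : IsUnimodular X V i₀ w) {A : Set L} (hA : IsClopen A) (hAV : MapsTo F.f A V) (α : ℝ)
    (hpos : ∀ x ∈ A, 0 ≤ Real.cos (F.θ x + α)) {x : L} (hx : x ∈ A) :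
    Real.cos (F.θ x + α) = 0 := by
  -- Since A is open and closed, extension by zero preserves smoothness and gives functions on all
  -- of L, so Stokes applies although only A is mapped into V.
  set W : Fin m → L → ℂ := fun j => A.indicator (w j ∘ F.f) with hW
  have hdet : ∀ x ∈ A, ∀ v : Fin m → TangentSpace (𝓡 m) x,
      Matrix.det (Matrix.of fun i j => cdiff m (W j) x (v i)) = F.omRestrict x v := by
    intro x hx v
    rw [OrientedLagrangian.omRestrict, hw.det_eq _ (hAV hx)]
    congr 2
    ext i j
    exact cdiff_indicator_comp_apply F.smooth hA hw.isOpen hAV (hw.contMDiffOn_one j) hx (v i)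
  have hdet0 : ∀ x ∉ A, ∀ v : Fin m → TangentSpace (𝓡 m) x,
      Matrix.det (Matrix.of fun i j => cdiff m (W j) x (v i)) = 0 := by
    intro x hx v
    refine Matrix.det_eq_zero_of_column_eq_zero i₀ fun i => ?_
    have h : W i₀ =ᶠ[𝓝 x] fun _ => 0 := by
      filter_upwards [hA.compl.isOpen.mem_nhds hx] with y hy
      exact indicator_of_notMem hy _
    rw [Matrix.of_apply, cdiff_congr h, cdiff_zero]
    rfl
  obtain ⟨v, hv, hv0⟩ := exists_linearIndependent_re_det_cdiff_eq_zero F.orientation i₀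
    (fun j => contMDiff_indicator_comp (by norm_num) F.smooth hA hw.isOpen hAV
      (hw.contMDiffOn_one j))
    (fun j hj => contMDiff_indicator_comp ENat.LEInfty.out F.smooth hA hw.isOpen hAV
      (hw.contMDiffOn_two j hj))
    (Complex.exp (Complex.I * α)) (w := W) (by
      intro y u
      by_cases hy : y ∈ A
      -- The frame sign occurs twice and squares away, leaving the volume density times a
      -- nonnegative cosine.
      · rw [hdet y hy, F.re_exp_mul_omRestrict, ← mul_assoc]
        refine mul_nonneg ?_ (mul_nonneg (Real.sqrt_nonneg _) (hpos y hy))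
        exact mul_self_nonneg _
      · rw [hdet0 y hy]
        simp) x
  rw [hdet x hx, F.re_exp_mul_omRestrict] at hv0
  have hs : frameSign (F.o x) v ≠ 0 := by
    unfold frameSign
    split_ifs <;> norm_num
  exact (mul_eq_zero.1 ((mul_eq_zero.1 hv0).resolve_left hs)).resolve_left
    (F.volDensity_pos hv).ne'

/-- The borderline value π needs a second use of `cos_eq_zero`: the first only forces the phase to
take two values at distance π, the second excludes a part of constant phase. -/
theorem pi_lt_phaseVariation [CompactSpace L] [T2Space L] {V : Set M} {i₀ : Fin m}
    {w : Fin m → M → ℂ} (hw : IsUnimodular X V i₀ w) {A : Set L} (hA : IsClopen A)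
    (hne : A.Nonempty) (hAV : MapsTo F.f A V) : Real.pi < F.phaseVariation := by
  by_contra! hle
  have hc : Continuous F.θ := F.smooth_θ.continuous
  have hb := isCompact_range hc
  have hS : ∀ x, F.θ x ≤ ⨆ x, F.θ x := le_ciSup hb.bddAbove
  have hI : ∀ x, ⨅ x, F.θ x ≤ F.θ x := ciInf_le hb.bddBelow
  unfold phaseVariation at hle
  set α : ℝ := -((⨆ x, F.θ x) + ⨅ x, F.θ x) / 2 with hα
  have hrange : ∀ x, F.θ x + α ∈ Icc (-(Real.pi / 2)) (Real.pi / 2) := fun x =>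
    ⟨by linarith [hI x], by linarith [hS x]⟩
  have hzero : ∀ x ∈ A, F.θ x + α = -(Real.pi / 2) ∨ F.θ x + α = Real.pi / 2 := by
    intro x hx
    have h0 := F.cos_eq_zero hw hA hAV α (fun y _ => Real.cos_nonneg_of_mem_Icc (hrange y)) hx
    by_contra! h
    exact (Real.cos_pos_of_mem_Ioo ⟨lt_of_le_of_ne (hrange x).1 h.1.symm,
      lt_of_le_of_ne (hrange x).2 h.2⟩).ne' h0
  obtain ⟨x₀, hx₀⟩ := hne
  -- On A two values of θ are equal or differ by π, so a closed condition coincides there with an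
  -- open one and the level set is open and closed.
  have hset : A ∩ {x | F.θ x = F.θ x₀} = A ∩ {x | |F.θ x - F.θ x₀| < Real.pi} := by
    ext x
    refine and_congr_right fun hx => ⟨fun h => ?_, fun h => ?_⟩
    · rw [mem_ofPred_eq] at h
      rw [mem_ofPred_eq, h, sub_self, abs_zero]
      exact Real.pi_pos
    · rw [mem_ofPred_eq, abs_lt] at h
      rw [mem_ofPred_eq]
      rcases hzero x hx with h1 | h1 <;> rcases hzero x₀ hx₀ with h2 | h2 <;> linarith [h.1, h.2]
  have hA' : IsClopen (A ∩ {x | F.θ x = F.θ x₀}) := by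
    refine ⟨hA.isClosed.inter (isClosed_eq hc continuous_const), ?_⟩
    rw [hset]
    exact hA.isOpen.inter (isOpen_lt (hc.sub continuous_const).abs continuous_const)
  have hone : ∀ x ∈ A ∩ {x | F.θ x = F.θ x₀}, Real.cos (F.θ x + -F.θ x₀) = 1 := by
    intro x hx
    rw [show F.θ x = F.θ x₀ from hx.2, add_neg_cancel, Real.cos_zero]
  have hx₀' : x₀ ∈ A ∩ {x | F.θ x = F.θ x₀} := ⟨hx₀, rfl⟩
  have h0 := F.cos_eq_zero hw hA' (hAV.mono_left inter_subset_left) (-F.θ x₀)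
    (fun x hx => by rw [hone x hx]; exact zero_le_one) hx₀'
  rw [hone x₀ hx₀'] at h0
  exact one_ne_zero h0

theorem not_almostCalibrated [CompactSpace L] [T2Space L] {V : Set M} {i₀ : Fin m}
    {w : Fin m → M → ℂ} (hw : IsUnimodular X V i₀ w) {A : Set L} (hA : IsClopen A)
    (hne : A.Nonempty) (hAV : MapsTo F.f A V) : ¬ F.AlmostCalibrated := by
  rintro ⟨α, hα⟩
  have hcos : ∀ x, 0 < Real.cos (F.θ x + α) := by
    intro x
    have : Nonempty (Fin m) := ⟨i₀⟩
    -- The calibration inequality speaks only about positive frames, so one is produced at each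
    -- point by adjusting a coordinate basis.
    set b := (coordBasis x x (mem_chart_source _ x)).adjustToOrientation (F.o x)
    have hb : IsPositiveFrame (F.o x) b :=
      ⟨b, rfl, Module.Basis.orientation_adjustToOrientation _ _⟩
    have h1 := hα x b hb
    have h2 := F.re_exp_mul_omRestrict α x b
    rw [frameSign, if_pos hb, one_mul, mul_comm Complex.I, Complex.mul_re,
      Complex.exp_ofReal_mul_I_re, Complex.exp_ofReal_mul_I_im] at h2
    rw [h2] at h1
    exact pos_of_mul_pos_right h1 (Real.sqrt_nonneg _)
  obtain ⟨x, hx⟩ := hne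
  exact (hcos x).ne' (F.cos_eq_zero hw hA hAV α (fun y _ => (hcos y).le) hx)

end GradedLagrangian

/-- The Riemannian distance of a continuous metric is compatible with the manifold topology. All δ ≤
δ₀ are allowed, including δ ≤ 0 where the ball is empty, as (c) does not require δ(t) to be
positive. -/
theorem HermitianData.exists_ball_subset [T2Space M] (X : HermitianData m M) {p : M} {V : Set M}
    (hV : V ∈ 𝓝 p) : ∃ δ₀ : ℝ, 0 < δ₀ ∧ ∀ δ ≤ δ₀, X.ball p δ ⊆ V := by
  let : RiemannianBundle (fun x : M => TangentSpace 𝓘(ℝ, Cm m) x) := ⟨X.g.toRiemannianMetric⟩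
  have : LocallyCompactSpace M := ChartedSpace.locallyCompactSpace (Cm m) M
  have : IsManifold 𝓘(ℝ, Cm m) 1 M := IsManifold.of_le (n := ω) le_top
  have : IsContinuousRiemannianBundle (Cm m) fun x : M => TangentSpace 𝓘(ℝ, Cm m) x :=
    ⟨X.g.inner, X.g.contMDiff.continuous, fun _ _ _ => rfl⟩
  obtain ⟨c, hc, hcV⟩ := setOfPred_riemannianEDist_lt_subset_nhds 𝓘(ℝ, Cm m) hV
  refine ⟨c, hc, fun δ hδ q hq => hcV ?_⟩
  have hq' : Manifold.riemannianEDist 𝓘(ℝ, Cm m) p q < ENNReal.ofReal δ := hq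
  refine hq'.trans_le ?_
  rw [← ENNReal.ofReal_coe_nnreal]
  exact ENNReal.ofReal_le_ofReal hδ

/-- Small balls in a Calabi–Yau manifold lie in a domain on which `Ω = dw₁ ∧ ⋯ ∧ dw_m`. -/
theorem HermitianData.IsCalabiYau.exists_ball_isUnimodular [T2Space M] {X : HermitianData m M}
    (hX : X.IsCalabiYau) (p : M) (i₀ : Fin m) :
    ∃ V w, IsUnimodular X V i₀ w ∧ ∃ δ₀ : ℝ, 0 < δ₀ ∧ ∀ δ ≤ δ₀, X.ball p δ ⊆ V := by
  obtain ⟨V, w, hp, hw⟩ := hX.exists_isUnimodular p i₀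
  exact ⟨V, w, hw, X.exists_ball_subset (hw.isOpen.mem_nhds hp)⟩

end Graded

end

/-! ### Flat space, small balls and collapsing families -/

theorem lemma3p26 (m : ℕ) (hm : 1 ≤ m) :
    -- compact graded Lagrangians in flat space
    (∀ (L : Type*) [TopologicalSpace L] [T2Space L] [CompactSpace L] [Nonempty L]
        [ChartedSpace (EuclideanSpace ℝ (Fin m)) L] [IsManifold (𝓡 m) ∞ L]
        (F : GradedLagrangian L (flatData m)),
        Real.pi < F.phaseVariation ∧ ¬ F.AlmostCalibrated) ∧
    -- compact graded Lagrangians in small balls of a Calabi–Yau manifold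
    (∀ (M : Type*) [TopologicalSpace M] [T2Space M] [ChartedSpace (Cm m) M]
        [IsManifold 𝓘(ℂ, Cm m) ω M] (X : HermitianData m M), X.IsCalabiYau → ∀ p : M,
        ∃ δ₀ : ℝ, 0 < δ₀ ∧ ∀ δ : ℝ, 0 < δ → δ ≤ δ₀ →
          ∀ (L : Type*) [TopologicalSpace L] [T2Space L] [CompactSpace L] [Nonempty L]
            [ChartedSpace (EuclideanSpace ℝ (Fin m)) L] [IsManifold (𝓡 m) ∞ L]
            (F : GradedLagrangian L X), (∀ x : L, F.f x ∈ X.ball p δ) →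
            Real.pi < F.phaseVariation ∧ ¬ F.AlmostCalibrated) ∧
    -- no part of an almost calibrated family collapses to a point
    (∀ (M : Type*) [TopologicalSpace M] [T2Space M] [ChartedSpace (Cm m) M]
        [IsManifold 𝓘(ℂ, Cm m) ω M] (X : HermitianData m M), X.IsCalabiYau → ∀ p : M,
        ∀ (T ε : ℝ), 0 < ε →
          ∀ (L : ℝ → Type*) [∀ t, TopologicalSpace (L t)] [∀ t, T2Space (L t)]
            [∀ t, CompactSpace (L t)] [∀ t, ChartedSpace (EuclideanSpace ℝ (Fin m)) (L t)]
            [∀ t, IsManifold (𝓡 m) ∞ (L t)] (F : ∀ t, GradedLagrangian (L t) X)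
            (L₁ : ∀ t, Set (L t)) (δ : ℝ → ℝ),
            Tendsto δ (𝓝[<] T) (𝓝 0) →
            (∀ t ∈ Ioo (T - ε) T, IsClopen (L₁ t) ∧ (L₁ t).Nonempty ∧
              ∀ x ∈ L₁ t, (F t).f x ∈ X.ball p (δ t)) →
            ∀ᶠ t in 𝓝[<] T, Real.pi < (F t).phaseVariation ∧ ¬ (F t).AlmostCalibrated) := by
  have i₀ : Fin m := ⟨0, hm⟩
  refine ⟨?_, ?_, ?_⟩
  · intro L _ _ _ _ _ _ F
    exact ⟨F.pi_lt_phaseVariation (flatData_isUnimodular i₀) isClopen_univ univ_nonempty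
        (mapsTo_univ _ _),
      F.not_almostCalibrated (flatData_isUnimodular i₀) isClopen_univ univ_nonempty
        (mapsTo_univ _ _)⟩
  · intro M _ _ _ _ X hX p
    obtain ⟨V, w, hw, δ₀, hδ₀, hV⟩ := hX.exists_ball_isUnimodular p i₀
    refine ⟨δ₀, hδ₀, fun δ _ hδ L _ _ _ _ _ _ F hF => ?_⟩
    have hFV : MapsTo F.f univ V := fun x _ => hV δ hδ (hF x)
    exact ⟨F.pi_lt_phaseVariation hw isClopen_univ univ_nonempty hFV,
      F.not_almostCalibrated hw isClopen_univ univ_nonempty hFV⟩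
  · intro M _ _ _ _ X hX p T ε hε L _ _ _ _ _ F L₁ δ hδ hL₁
    obtain ⟨V, w, hw, δ₀, hδ₀, hV⟩ := hX.exists_ball_isUnimodular p i₀
    -- As δ(t) → 0 < δ₀, eventually δ(t) ≤ δ₀, so the collapsing part lies in V, and the clopen
    -- version of the argument applies to it alone.
    filter_upwards [hδ.eventually (ge_mem_nhds hδ₀),
      Ioo_mem_nhdsLT (show T - ε < T by linarith)] with t ht htT
    obtain ⟨hA, hne, hsub⟩ := hL₁ t htT
    have hFV : MapsTo (F t).f (L₁ t) V := fun x hx => hV _ ht (hsub x hx)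
    exact ⟨(F t).pi_lt_phaseVariation hw hA hne hFV, (F t).not_almostCalibrated hw hA hne hFV⟩
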